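/- For integers $k,n\ge 1$, the \emph{Razak block} with parameters $(k,n)$ is the $\mathrm{C}^*$-algebra $$\{f\in C([0,1],M_k\otimes M_n)\mid f(0)=c\otimes 1_{n-1},\ f(1)=c\otimes 1_n \text{ for some } c\in M_k\},$$ where $M_k\otimes M_n=M_{kn}$ is the algebra of complex $kn\times kn$ matrices and $1_{n-1}\in M_n$ is the diagonal projection with diagonal entries $1,\dots,1,0$. Let $A$ be a $\mathrm{C}^*$-algebra with unitisation $\tilde A$, and let $A^+$ be the set of its positive elements. For $x\in A^+$ and $s\ge 0$, let $e_s(x)=(x-s)_+$, defined by functional calculus. For $x,y\in A^+$ write $x\precsim y$ (Cuntz subequivalence) if there are $v_m\in A\otimes\mathcal K$, $m\in\mathbb N$, with $\|x-v_m y v_m^*\|\to 0$, where $\mathcal K$ is the algebra of compact operators on $\ell^2(\mathbb N)$ and $x,y$ are identified with $x\otimes e_{11},y\otimes e_{11}\in A\otimes\mathcal K$. For $a,b\in A^+$ define $$d_U(a,b)=\inf\{\|uau^*-b\| \mid u\in\tilde A \text{ unitary}\},$$ $$d_W(a,b)=\inf\{r>0\mid e_{t+r}(a)\precsim e_t(b)\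 \text{and}\ e_{t+r}(b)\precsim e_t(a)\ \text{for all } t>0\}.$$ \textbf{Corollary.} Let $A$ be the $\mathrm{C}^*$-algebra inductive limit of a sequence $B_0\to B_1\to B_2\to\cdots$ of $*$-homomorphisms (not necessarily injective), where each $B_i$ is a finite direct sum of Razak blocks. Then $d_U(a,b)=d_W(a,b)$ for all $a,b\in A^+$. -/

import Mathlib

open Filter Topology
open scoped Kronecker ENNReal unitInterval Matrix Matrix.Norms.L2Operator

noncomputable section

/-! ### The stabilisation `A ⊗ 𝒦` as an algebra of infinite matrices -/

namespace Stab

variable {A : Type*} [NonUnitalCStarAlgebra A]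

/-- The upper left `N × N` block of an infinite matrix over `A`, as an element of the
C⋆-algebra `M_N(A)`. -/
def block (N : ℕ) (v : Matrix ℕ ℕ A) : CStarMatrix (Fin N) (Fin N) A :=
  CStarMatrix.ofMatrix (fun i j => v i j)

/-- The upper left `N × N` block, padded with zeros. -/
def cut (N : ℕ) (v : Matrix ℕ ℕ A) : Matrix ℕ ℕ A :=
  fun i j => if i < N ∧ j < N then v i j else 0

/-- The matrix `a ⊗ e₁₁`. -/
def corner (a : A) : Matrix ℕ ℕ A :=
  fun i j => if i = 0 ∧ j = 0 then a else 0

/-- The matrix product (the series converge in norm for matrices in `A ⊗ 𝒦`). -/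
def mul (v w : Matrix ℕ ℕ A) : Matrix ℕ ℕ A :=
  fun i j => ∑' l, v i l * w l j

variable [PartialOrder A] [StarOrderedRing A]

/-- The operator norm of an infinite matrix: the supremum of the norms of its finite blocks
`v_N ∈ M_N(A)` (possibly `∞`). -/
def norm (v : Matrix ℕ ℕ A) : ℝ≥0∞ := ⨆ N : ℕ, ‖block N v‖ₑ

/-- `A ⊗ 𝒦`, the norm closure of `⋃ N, M_N(A)`: the infinite matrices over `A` that are the norm
limit of their finite upper left blocks. -/
def IsMem (v : Matrix ℕ ℕ A) : Prop :=
  Tendsto (fun N => norm (v - cut N v)) atTop (𝓝 0)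

end Stab

section Distances

variable {A : Type*} [NonUnitalCStarAlgebra A]

/-- `e_s(x) = (x - s)₊`, by functional calculus (for `x` positive and `s ≥ 0`). -/
def cutDown (s : ℝ) (x : A) : A := cfcₙ (fun t : ℝ => max 0 (t - s)) x

/-- The distance between unitary orbits,
`d_U(a, b) = inf {‖u a u⋆ - b‖ | u a unitary in the unitisation of A}`.
(When `A` has a unit, `Unitization ℂ A ≅ A ⊕ ℂ`, and the elements `u a u⋆` are the same as for
unitaries `u` of `A` itself.) -/
def dU (a b : A) : ℝ :=
  ⨅ u : unitary (Unitization ℂ A),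
    ‖(u : Unitization ℂ A) * (a : Unitization ℂ A) * star (u : Unitization ℂ A)
      - (b : Unitization ℂ A)‖

variable [PartialOrder A] [StarOrderedRing A]

/-- Cuntz subequivalence `x ≾ y`: there are `v_n ∈ A ⊗ 𝒦` with `‖x - v_n y v_n⋆‖ → 0`, where `x`
and `y` are regarded as the elements `x ⊗ e₁₁` and `y ⊗ e₁₁` of `A ⊗ 𝒦`. -/
def CuntzLE (x y : A) : Prop :=
  ∃ v : ℕ → Matrix ℕ ℕ A, (∀ n, Stab.IsMem (v n)) ∧
    Tendsto (fun n => Stab.norm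
      (Stab.corner x - Stab.mul (Stab.mul (v n) (Stab.corner y)) (v n)ᴴ)) atTop (𝓝 0)

/-- The pseudometric `d_W` defined through Cuntz comparison of spectral cut-downs. -/
def dW (a b : A) : ℝ :=
  sInf {r : ℝ | 0 < r ∧ ∀ t : ℝ, 0 < t →
    CuntzLE (cutDown (t + r) a) (cutDown t b) ∧ CuntzLE (cutDown (t + r) b) (cutDown t a)}

end Distances

/-! ### Razak blocks -/

section Razak

/-- The projection `1_{n-1}` in `M_n`: the diagonal matrix with `n - 1` ones and last entry `0`. -/
def cornerOne (n : ℕ) : Matrix (Fin n) (Fin n) ℂ :=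
  Matrix.diagonal (fun j => if (j : ℕ) + 1 < n then 1 else 0)

lemma cornerOne_mul_self (n : ℕ) : cornerOne n * cornerOne n = cornerOne n := by
  simp [cornerOne, Matrix.diagonal_mul_diagonal]

lemma cornerOne_conjTranspose (n : ℕ) : (cornerOne n)ᴴ = cornerOne n := by
  rw [cornerOne, Matrix.diagonal_conjTranspose]
  congr 1
  ext j
  by_cases h : (j : ℕ) + 1 < n <;> simp [h]

/-- The Razak block
`{f ∈ C([0,1], M_k ⊗ M_n) | f(0) = c ⊗ 1_{n-1}, f(1) = c ⊗ 1_n for some c ∈ M_k}`,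
a C⋆-subalgebra of `C([0,1], M_k ⊗ M_n)`, where `M_k ⊗ M_n = M_{kn}` via the Kronecker product. -/
def razakBlock (k n : ℕ) :
    NonUnitalStarSubalgebra ℂ C(I, Matrix (Fin k × Fin n) (Fin k × Fin n) ℂ) where
  carrier := {f | ∃ c : Matrix (Fin k) (Fin k) ℂ, f 0 = c ⊗ₖ cornerOne n ∧ f 1 = c ⊗ₖ 1}
  zero_mem' := ⟨0, by simp, by simp⟩
  add_mem' := by
    rintro f g ⟨c, hc0, hc1⟩ ⟨d, hd0, hd1⟩
    exact ⟨c + d, by simp [hc0, hd0, Matrix.add_kronecker], by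
      simp [hc1, hd1, Matrix.add_kronecker]⟩
  mul_mem' := by
    rintro f g ⟨c, hc0, hc1⟩ ⟨d, hd0, hd1⟩
    refine ⟨c * d, ?_, ?_⟩
    · rw [ContinuousMap.mul_apply, hc0, hd0, ← Matrix.mul_kronecker_mul, cornerOne_mul_self]
    · rw [ContinuousMap.mul_apply, hc1, hd1, ← Matrix.mul_kronecker_mul, one_mul]
  smul_mem' := by
    rintro z f ⟨c, hc0, hc1⟩
    exact ⟨z • c, by simp [hc0, Matrix.smul_kronecker], by simp [hc1, Matrix.smul_kronecker]⟩
  star_mem' := by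
    rintro f ⟨c, hc0, hc1⟩
    refine ⟨cᴴ, ?_, ?_⟩
    · rw [ContinuousMap.star_apply, hc0, Matrix.star_eq_conjTranspose,
        Matrix.conjTranspose_kronecker, cornerOne_conjTranspose]
    · rw [ContinuousMap.star_apply, hc1, Matrix.star_eq_conjTranspose,
        Matrix.conjTranspose_kronecker, Matrix.conjTranspose_one]

instance razakBlock_isClosed (k n : ℕ) :
    IsClosed (razakBlock k n :
      Set C(I, Matrix (Fin k × Fin n) (Fin k × Fin n) ℂ)) := by
  let L : Matrix (Fin k) (Fin k) ℂ →ₗ[ℂ]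
      Matrix (Fin k × Fin n) (Fin k × Fin n) ℂ × Matrix (Fin k × Fin n) (Fin k × Fin n) ℂ :=
    { toFun := fun c => (c ⊗ₖ cornerOne n, c ⊗ₖ 1)
      map_add' := fun c d => by simp [Matrix.add_kronecker]
      map_smul' := fun z c => by simp [Matrix.smul_kronecker] }
  have hcl : IsClosed (LinearMap.range L :
      Set (Matrix (Fin k × Fin n) (Fin k × Fin n) ℂ × Matrix (Fin k × Fin n) (Fin k × Fin n) ℂ)) :=
    (LinearMap.range L).closed_of_finiteDimensional
  have hev : Continuous (fun f : C(I, Matrix (Fin k × Fin n) (Fin k × Fin n) ℂ) => (f 0, f 1)) :=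
    (continuous_eval_const 0).prodMk (continuous_eval_const 1)
  convert hcl.preimage hev using 1
  ext f
  constructor
  · rintro ⟨c, h0, h1⟩
    exact ⟨c, Prod.ext h0.symm h1.symm⟩
  · rintro ⟨c, hc⟩
    exact ⟨c, (congrArg Prod.fst hc).symm, (congrArg Prod.snd hc).symm⟩

/-- The finite direct sum of the Razak blocks of sizes `(k 0, n 0), …, (k (l - 1), n (l - 1))`,
a C⋆-algebra with componentwise operations and the maximum norm. -/
def RazakSum (l : ℕ) (k n : Fin l → ℕ) : Type :=
  ∀ j : Fin l, razakBlock (k j) (n j)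

instance (l : ℕ) (k n : Fin l → ℕ) : NonUnitalCStarAlgebra (RazakSum l k n) :=
  inferInstanceAs (NonUnitalCStarAlgebra (∀ j : Fin l, razakBlock (k j) (n j)))

end Razak

/-! ### Sequential inductive limits -/

section Limits

variable {B : ℕ → Type*} [∀ i, NonUnitalCStarAlgebra (B i)]

/-- The composite connecting map `φ_{i+m-1} ∘ ⋯ ∘ φ_{i+1} ∘ φ_i : B_i → B_{i+m}`. -/
def connect (φ : ∀ i, B i →⋆ₙₐ[ℂ] B (i + 1)) (i : ℕ) : ∀ m : ℕ, B i →⋆ₙₐ[ℂ] B (i + m)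
  | 0 => NonUnitalStarAlgHom.id ℂ (B i)
  | m + 1 => (φ (i + m)).comp (connect φ i m)

/-- `(A, μ)` is the C⋆-algebra inductive limit of `B_0 → B_1 → B_2 → ⋯` (the connecting maps need
not be injective): the `μ_i : B_i → A` are compatible with the connecting maps, and they identify
`A` with the completion of the algebraic direct limit in the C⋆-seminorm
`‖[x]‖ = lim_m ‖φ_{i,i+m}(x)‖`, `x ∈ B_i`. -/
structure IsInductiveLimit {A : Type*} [NonUnitalCStarAlgebra A]
    (φ : ∀ i, B i →⋆ₙₐ[ℂ] B (i + 1)) (μ : ∀ i, B i →⋆ₙₐ[ℂ] A) : Prop where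
  compatible : ∀ i x, μ (i + 1) (φ i x) = μ i x
  norm_eq : ∀ i x, Tendsto (fun m => ‖connect φ i m x‖) atTop (𝓝 ‖μ i x‖)
  dense : Dense (⋃ i, Set.range (μ i))

/-- `A` is a sequential inductive limit of finite direct sums of Razak blocks. -/
def IsLimitOfRazakSums (A : Type*) [NonUnitalCStarAlgebra A] : Prop :=
  ∃ (l : ℕ → ℕ) (k n : ∀ i, Fin (l i) → ℕ)
    (φ : ∀ i, RazakSum (l i) (k i) (n i) →⋆ₙₐ[ℂ] RazakSum (l (i + 1)) (k (i + 1)) (n (i + 1)))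
    (μ : ∀ i, RazakSum (l i) (k i) (n i) →⋆ₙₐ[ℂ] A),
    (∀ i j, 0 < k i j ∧ 0 < n i j) ∧
      IsInductiveLimit (B := fun i => RazakSum (l i) (k i) (n i)) φ μ

end Limits

end

/-!
The inequality `dW ≤ dU` (`dW_le_dU`) holds in every C⋆-algebra. Conjugation by a unitary of the
unitisation preserves the Cuntz classes of cut-downs (`CuntzLE.of_inr_eq`), and if `‖a - b‖ ≤ r`,
then `a - (t + r) ≤ (b - t)₊` in the unitisation; compressing by functions of `a` and using that
`0 ≤ x ≤ y` implies `x ≾ y` gives `e_{t+r}(a) ≾ e_t(b)` (`cuntzLE_cutDown_of_norm_sub_le`).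

For `dU ≤ dW`, let `r` be admissible in the definition of `dW` and let `ε > 0`. Approximate `a` and
`b` by positive elements of a finite stage. Only finitely many levels `t`, on a grid of mesh `ε`,
matter, and for these the Cuntz comparisons hold approximately at a later finite stage
(`IsInductiveLimit.exists_stage_finset`). In a representation of this stage on matrices, a
comparison of cut-downs bounds the number of large eigenvalues of one matrix by that of the other
(`card_le_card_of_norm_sub_lt`), so the eigenvalues in increasing order are within `r` up to
multiples of `ε`, and a unitary matching the two eigenbases in this order moves the first matrix to
within that distance of the second (`exists_matching_of_hom`).

It remains to choose the matching unitaries continuously over `[0,1]`, with the boundary conditions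
of a Razak block. The relation "`u` matches `a` and `b`" is compact, and any two matching unitaries
for the same `a` and `b` differ by unitaries in commutants of diagonal matrices, which are path
connected (`Matching.joinedIn`). So matching unitaries at nearby points can be joined through almost
matching ones, and these paths can be glued with prescribed end points
(`exists_continuous_of_matching`). At the end points `0` and `1` one takes
`w ⊗ 1_{n-1} + 1 ⊗ e_{nn}` and `w ⊗ 1_n`, where `w` matches the coefficients in `M_k`; these match because `0` is the smallest
eigenvalue of a positive matrix, and they make the path a unitary `1 + z` with `z` in the block
(`exists_unitary_razakBlock`).
-/

noncomputable section

/-! ### Cuntz subequivalence inside the algebra -/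

section Cuntz

variable {A : Type*} [NonUnitalCStarAlgebra A]

lemma Stab.mul_corner_conjTranspose_zero_zero (v : Matrix ℕ ℕ A) (y : A) :
    Stab.mul (Stab.mul v (Stab.corner y)) vᴴ 0 0 = v 0 0 * y * star (v 0 0) := by
  have h : ∀ l, Stab.mul v (Stab.corner y) 0 l = if l = 0 then v 0 0 * y else 0 := by
    intro l
    unfold Stab.mul Stab.corner
    rw [tsum_eq_single 0 (by intro b hb; simp [hb])]
    by_cases hl : l = 0 <;> simp [hl]
  unfold Stab.mul at h ⊢
  rw [tsum_eq_single 0 (by intro b hb; rw [h]; simp [hb]), h]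
  simp [Matrix.conjTranspose_apply]

lemma Stab.mul_corner_corner (v y : A) :
    Stab.mul (Stab.corner v) (Stab.corner y) = Stab.corner (v * y) := by
  funext i j
  unfold Stab.mul Stab.corner
  rw [tsum_eq_single 0 (by intro b hb; simp [hb])]
  by_cases hi : i = 0 <;> by_cases hj : j = 0 <;> simp [hi, hj]

lemma Stab.corner_conjTranspose (v : A) : (Stab.corner v)ᴴ = Stab.corner (star v) := by
  funext i j
  rw [Matrix.conjTranspose_apply]
  unfold Stab.corner
  by_cases hi : i = 0 <;> by_cases hj : j = 0 <;> simp [hi, hj]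

lemma Stab.corner_sub (v w : A) : Stab.corner v - Stab.corner w = Stab.corner (v - w) := by
  funext i j
  change Stab.corner v i j - Stab.corner w i j = _
  unfold Stab.corner
  by_cases hi : i = 0 <;> by_cases hj : j = 0 <;> simp [hi, hj]

variable [PartialOrder A] [StarOrderedRing A]

lemma Stab.enorm_zero_zero_le (v : Matrix ℕ ℕ A) : ‖v 0 0‖ₑ ≤ Stab.norm v := by
  refine le_trans ?_ (le_iSup (fun N : ℕ => ‖Stab.block N v‖ₑ) 1)
  rw [enorm_le_iff_norm_le]
  exact CStarMatrix.norm_entry_le_norm (M := Stab.block 1 v) (i := 0) (j := 0)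

omit [PartialOrder A] [StarOrderedRing A] in
lemma Stab.block_corner_apply (N : ℕ) (v : A) (i j : Fin N) :
    Stab.block N (Stab.corner v) i j = if (i : ℕ) = 0 ∧ (j : ℕ) = 0 then v else 0 := rfl

/-- The corner embedding `A → M_N(A)`. -/
def Stab.cornerHom (N : ℕ) : A →⋆ₙₐ[ℂ] CStarMatrix (Fin N) (Fin N) A where
  toFun v := Stab.block N (Stab.corner v)
  map_smul' z v := by
    ext i j
    simp [Stab.block_corner_apply]
  map_zero' := by
    ext i j
    simp [Stab.block_corner_apply]
  map_add' v w := by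
    ext i j
    by_cases h : (i : ℕ) = 0 ∧ (j : ℕ) = 0 <;> simp [Stab.block_corner_apply, h]
  map_mul' v w := by
    ext i j
    rw [CStarMatrix.mul_apply]
    obtain _ | N := N
    · exact i.elim0
    rw [Finset.sum_eq_single 0 (by
      intro l _ hl
      have : (l : ℕ) ≠ 0 := fun h => hl (Fin.ext h)
      simp [Stab.block_corner_apply, this]) (by simp)]
    by_cases hi : (i : ℕ) = 0 <;> by_cases hj : (j : ℕ) = 0 <;>
      simp [Stab.block_corner_apply, hi, hj]
  map_star' v := by
    ext i j
    rw [CStarMatrix.star_apply]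
    by_cases hi : (i : ℕ) = 0 <;> by_cases hj : (j : ℕ) = 0 <;>
      simp [Stab.block_corner_apply, hi, hj]

lemma Stab.norm_corner_le (v : A) : Stab.norm (Stab.corner v) ≤ ‖v‖ₑ := by
  refine iSup_le fun N => ?_
  rw [enorm_le_iff_norm_le]
  exact NonUnitalStarAlgHom.norm_apply_le (Stab.cornerHom N) v

lemma Stab.isMem_corner (v : A) : Stab.IsMem (Stab.corner v) := by
  refine tendsto_const_nhds.congr' ?_
  filter_upwards [eventually_ge_atTop 1] with N hN
  have : Stab.corner v - Stab.cut N (Stab.corner v) = Stab.corner 0 := by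
    funext i j
    change Stab.corner v i j - _ = _
    unfold Stab.corner Stab.cut
    by_cases hi : i = 0 <;> by_cases hj : j = 0 <;> simp [hi, hj,
        Nat.pos_of_ne_zero (by omega : N ≠ 0)]
  rw [this]
  symm
  simpa using Stab.norm_corner_le (0 : A)

/-- Stabilising does not change Cuntz subequivalence: the conjugating elements can be taken in
the algebra itself, since only the upper left entries of the matrices matter. -/
lemma cuntzLE_iff {x y : A} :
    CuntzLE x y ↔ ∀ ε : ℝ, 0 < ε → ∃ v : A, ‖x - v * y * star v‖ < ε := by
  constructor
  · rintro ⟨v, -, hv⟩ ε hε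
    obtain ⟨n, hn⟩ := (hv.eventually (gt_mem_nhds (ENNReal.ofReal_pos.2 hε))).exists
    refine ⟨v n 0 0, ?_⟩
    have h := (Stab.enorm_zero_zero_le _).trans_lt hn
    rw [Matrix.sub_apply, Stab.mul_corner_conjTranspose_zero_zero] at h
    rw [← ofReal_norm, ENNReal.ofReal_lt_ofReal_iff hε] at h
    simpa [Stab.corner] using h
  · intro h
    choose! v hv using fun n : ℕ => h (1 / ((n : ℝ) + 1)) (by positivity)
    refine ⟨fun n => Stab.corner (v n), fun n => Stab.isMem_corner _, ?_⟩
    simp only [Stab.corner_conjTranspose, Stab.mul_corner_corner, Stab.corner_sub]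
    refine tendsto_of_tendsto_of_tendsto_of_le_of_le tendsto_const_nhds ?_
      (fun n => bot_le) (fun n => Stab.norm_corner_le _)
    have := tendsto_of_tendsto_of_tendsto_of_le_of_le tendsto_const_nhds
      tendsto_one_div_add_atTop_nhds_zero_nat (fun n => norm_nonneg _) (fun n => (hv n).le)
    simpa [ofReal_norm] using ENNReal.tendsto_ofReal this

lemma CuntzLE.trans {x y z : A} (hxy : CuntzLE x y) (hyz : CuntzLE y z) : CuntzLE x z := by
  rw [cuntzLE_iff] at *
  intro ε hε
  obtain ⟨v, hv⟩ := hxy (ε / 2) (half_pos hε)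
  obtain ⟨w, hw⟩ := hyz (ε / 2 / (‖v‖ * ‖v‖ + 1)) (by positivity)
  refine ⟨v * w, ?_⟩
  have e : x - v * w * z * star (v * w) = (x - v * y * star v) +
      v * (y - w * z * star w) * star v := by
    simp only [star_mul, mul_sub, sub_mul, mul_assoc]; abel
  rw [e]
  refine (norm_add_le _ _).trans_lt ?_
  have : ‖v * (y - w * z * star w) * star v‖ ≤ ε / 2 := by
    calc _ ≤ ‖v‖ * ‖y - w * z * star w‖ * ‖v‖ := by
          refine (norm_mul_le _ _).trans ?_
          rw [norm_star]
          gcongr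
          exact norm_mul_le _ _
      _ = ‖y - w * z * star w‖ * (‖v‖ * ‖v‖) := by ring
      _ ≤ ε / 2 / (‖v‖ * ‖v‖ + 1) * (‖v‖ * ‖v‖ + 1) := by gcongr; linarith
      _ = ε / 2 := by field_simp
  linarith

lemma cuntzLE_zero (y : A) : CuntzLE 0 y :=
  cuntzLE_iff.2 fun ε hε => ⟨0, by simpa using hε⟩

/-- The elements that are Cuntz below `y` form a closed set. -/
lemma CuntzLE.of_forall_exists {x y : A}
    (h : ∀ ε : ℝ, 0 < ε → ∃ z, ‖x - z‖ < ε ∧ CuntzLE z y) : CuntzLE x y := by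
  rw [cuntzLE_iff]
  intro ε hε
  obtain ⟨z, hz, hzy⟩ := h (ε / 2) (half_pos hε)
  obtain ⟨v, hv⟩ := cuntzLE_iff.1 hzy (ε / 2) (half_pos hε)
  refine ⟨v, ?_⟩
  calc _ = ‖(x - z) + (z - v * y * star v)‖ := by congr 1; abel
    _ ≤ _ := norm_add_le _ _
    _ < ε := by linarith

lemma exists_norm_mul_sub_lt (x : A) {ε : ℝ} (hε : 0 < ε) :
    ∃ e : A, ‖e‖ ≤ 1 ∧ IsSelfAdjoint e ∧ ‖e * x - x‖ < ε := by
  have h := CStarAlgebra.increasingApproximateUnit A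
  have h1 := (h.tendsto_mul_right x).eventually (Metric.ball_mem_nhds _ hε)
  have h2 := h.eventually_norm
  have h3 := h.eventually_isSelfAdjoint
  obtain ⟨e, h1, h2, h3⟩ := (h1.and (h2.and h3)).exists
  exact ⟨e, h2, h3, by simpa [dist_eq_norm] using h1⟩

/-- Conjugating by an element of the unitisation does not increase the Cuntz class: an approximate
unit moves the conjugating element into the algebra. -/
lemma CuntzLE.of_inr_eq {x y : A} (w : Unitization ℂ A) (hy : IsSelfAdjoint y)
    (h : (x : Unitization ℂ A) = w * y * star w) : CuntzLE x y := by
  rw [cuntzLE_iff]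
  intro ε hε
  obtain ⟨e, he1, hes, he⟩ := exists_norm_mul_sub_lt y
    (show 0 < ε / (2 * (‖w‖ * ‖w‖ + 1)) by positivity)
  have hv : ∃ v : A, (v : Unitization ℂ A) = w * e := by
    refine ⟨(w * e).snd, ?_⟩
    ext <;> simp
  obtain ⟨v, hv⟩ := hv
  refine ⟨v, ?_⟩
  rw [← Unitization.norm_inr (𝕜 := ℂ)]
  have e1 : ((x - v * y * star v : A) : Unitization ℂ A)
      = w * (((y - e * y : A) : Unitization ℂ A) + (e : Unitization ℂ A) *
        ((y - y * e : A) : Unitization ℂ A)) * star w := by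
    simp only [Unitization.inr_sub, Unitization.inr_mul, Unitization.inr_star, h, hv, star_mul]
    rw [← Unitization.inr_star, hes.star_eq]
    simp only [mul_sub, sub_mul, mul_add, add_mul, mul_assoc]; abel
  have e2 : ‖y - y * e‖ = ‖e * y - y‖ := by
    rw [← norm_star, star_sub, star_mul, hy.star_eq, hes.star_eq, norm_sub_rev]
  rw [e1]
  have : ‖((y - e * y : A) : Unitization ℂ A) + (e : Unitization ℂ A) *
        ((y - y * e : A) : Unitization ℂ A)‖ ≤ 2 * ‖e * y - y‖ := by
    refine (norm_add_le _ _).trans ?_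
    have := norm_mul_le (e : Unitization ℂ A) ((y - y * e : A) : Unitization ℂ A)
    rw [Unitization.norm_inr, Unitization.norm_inr, e2] at this
    rw [Unitization.norm_inr, norm_sub_rev]
    nlinarith [norm_nonneg (e * y - y), norm_nonneg e]
  calc _ ≤ ‖w‖ * (2 * ‖e * y - y‖) * ‖w‖ := by
          refine (norm_mul_le _ _).trans ?_
          rw [norm_star]
          gcongr
          exact (norm_mul_le _ _).trans (by gcongr)
      _ = ‖e * y - y‖ * (2 * (‖w‖ * ‖w‖)) := by ring
      _ ≤ ‖e * y - y‖ * (2 * (‖w‖ * ‖w‖ + 1)) := by gcongr; linarith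
      _ < ε / (2 * (‖w‖ * ‖w‖ + 1)) * (2 * (‖w‖ * ‖w‖ + 1)) := by gcongr
      _ = ε := by field_simp

end Cuntz

/-! ### Cuntz comparison of spectral cut-downs -/

section CutDown

variable {A : Type*} [NonUnitalCStarAlgebra A]

lemma cutDown_fun_zero {s : ℝ} (hs : 0 ≤ s) : max 0 ((0 : ℝ) - s) = 0 := by simpa using hs

variable [PartialOrder A] [StarOrderedRing A]

/-- Domination implies Cuntz subequivalence. With `d = x^{1/2} y^{1/2} (y + δ)⁻¹` one has
`x - d y d⋆ = x^{1/2} k(y) x^{1/2}` for `k(s) = 1 - s² / (s + δ)²`, which has the same norm as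
`k(y)^{1/2} x k(y)^{1/2} ≤ y k(y) ≤ 2δ`. -/
lemma cuntzLE_of_le {x y : A} (hx : 0 ≤ x) (hxy : x ≤ y) : CuntzLE x y := by
  rw [cuntzLE_iff]
  intro ε hε
  obtain ⟨δ, hδ, hδε⟩ : ∃ δ : ℝ, 0 < δ ∧ 2 * δ < ε := ⟨ε / 4, by positivity, by linarith⟩
  have hy : 0 ≤ y := hx.trans hxy
  have hya : IsSelfAdjoint y := hy.isSelfAdjoint
  have hYa : IsSelfAdjoint (y : Unitization ℂ A) := hya.inr ℂ
  have hY0 : 0 ≤ (y : Unitization ℂ A) := Unitization.inr_nonneg_iff.2 hy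
  have hden : ∀ s : ℝ, |s| + δ ≠ 0 := fun s => by positivity
  set p : A := CFC.sqrt x with hp
  have hpp : p * p = x := CFC.sqrt_mul_sqrt_self x hx
  have hpa : IsSelfAdjoint p := (CFC.sqrt_nonneg x).isSelfAdjoint
  set fq : ℝ → ℝ := fun s => √s / (|s| + δ) with hfq
  have hfqc : Continuous fq := by fun_prop (disch := assumption)
  have hfq0 : fq 0 = 0 := by simp [hfq]
  set fm : ℝ → ℝ := fun s => √(1 - (s / (|s| + δ)) ^ 2) with hfm
  have hfmc : Continuous fm := by fun_prop (disch := assumption)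
  set q : A := cfcₙ fq y with hq
  have hqa : IsSelfAdjoint q := cfcₙ_predicate fq y
  set Q : Unitization ℂ A := (q : Unitization ℂ A) with hQ
  have hQ' : Q = cfc fq (y : Unitization ℂ A) := Unitization.real_cfcₙ_eq_cfc_inr y fq hfq0
  set m : Unitization ℂ A := cfc fm (y : Unitization ℂ A) with hm
  have hma : IsSelfAdjoint m := cfc_predicate fm _
  have hPa : IsSelfAdjoint (p : Unitization ℂ A) := hpa.inr ℂ
  have hspec : ∀ s ∈ spectrum ℝ (y : Unitization ℂ A), 0 ≤ s :=
    fun s hs => spectrum_nonneg_of_nonneg hY0 hs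
  have hle1 : ∀ s : ℝ, (s / (|s| + δ)) ^ 2 ≤ 1 := by
    intro s
    rw [sq_le_one_iff_abs_le_one, abs_div, abs_of_pos (show 0 < |s| + δ by positivity),
      div_le_one (by positivity)]
    linarith
  have hcid : Continuous (fun s : ℝ => s) := continuous_id
  have key : 1 - Q * y * Q = m * m := by
    have h1 : Q * y * Q = cfc (fun s => fq s * s * fq s) (y : Unitization ℂ A) := by
      rw [cfc_mul _ _ _ (by fun_prop) (by fun_prop), cfc_mul _ _ _ (by fun_prop) (by fun_prop),
        cfc_id' ℝ (y : Unitization ℂ A), hQ']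
    rw [h1, hm, ← cfc_mul _ _ _ (by fun_prop) (by fun_prop), ← cfc_one ℝ (y : Unitization ℂ A),
      ← cfc_sub _ _ _ (by fun_prop) (by fun_prop)]
    refine cfc_congr fun s hs => ?_
    have hs0 := hspec s hs
    simp only [hfm, hfq, Pi.one_apply]
    rw [Real.mul_self_sqrt (by linarith [hle1 s])]
    have : √s * √s = s := Real.mul_self_sqrt hs0
    have e : √s / (|s| + δ) * s * (√s / (|s| + δ)) = (√s * √s) * s / (|s| + δ) ^ 2 := by
      field_simp
    rw [e, this, div_pow, sq s]
  have hmYm : m * y * m = cfc (fun s => fm s * s * fm s) (y : Unitization ℂ A) := by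
    rw [cfc_mul _ _ _ (by fun_prop) (by fun_prop), cfc_mul _ _ _ (by fun_prop) (by fun_prop),
        cfc_id' ℝ (y : Unitization ℂ A)]
  have hnorm : ‖m * y * m‖ ≤ 2 * δ := by
    rw [hmYm]
    refine norm_cfc_le (by positivity) fun s hs => ?_
    have hs0 := hspec s hs
    have e : fm s * s * fm s = s * (1 - (s / (s + δ)) ^ 2) := by
      rw [mul_right_comm, hfm]
      simp only
      rw [Real.mul_self_sqrt (by linarith [hle1 s]), abs_of_nonneg hs0, mul_comm]
    have h2 := hle1 s
    rw [abs_of_nonneg hs0] at h2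
    rw [e, Real.norm_eq_abs, abs_of_nonneg (mul_nonneg hs0 (by linarith))]
    have hsd : 0 < s + δ := by positivity
    have : s * (1 - (s / (s + δ)) ^ 2) = s * (2 * s + δ) * δ / (s + δ) ^ 2 := by
      field_simp; ring
    rw [this, div_le_iff₀ (by positivity)]
    nlinarith [mul_nonneg hs0 hδ.le, mul_pos hδ hδ, mul_nonneg hs0 (mul_pos hδ hδ).le,
      mul_pos hδ (mul_pos hδ hδ)]
  refine ⟨p * q, ?_⟩
  have e1 : ((x - p * q * y * star (p * q) : A) : Unitization ℂ A)
      = ((p : Unitization ℂ A) * m) * star ((p : Unitization ℂ A) * m) := by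
    rw [star_mul, star_mul, hpa.star_eq, hqa.star_eq, hma.star_eq, hPa.star_eq, ← hpp]
    simp only [Unitization.inr_sub, Unitization.inr_mul]
    calc _ = (p : Unitization ℂ A) * (1 - Q * y * Q) * p := by
          simp only [mul_sub, sub_mul, mul_assoc, mul_one, hQ]
      _ = _ := by rw [key]; simp only [mul_assoc]
  have e2 : star ((p : Unitization ℂ A) * m) * ((p : Unitization ℂ A) * m) = m * x * m := by
    rw [star_mul, hma.star_eq, hPa.star_eq, ← hpp]
    simp only [Unitization.inr_mul, mul_assoc]
  rw [← Unitization.norm_inr (𝕜 := ℂ), e1, CStarRing.norm_self_mul_star,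
    ← CStarRing.norm_star_mul_self, e2]
  refine lt_of_le_of_lt ?_ hδε
  refine le_trans ?_ hnorm
  have hX0 : 0 ≤ (x : Unitization ℂ A) := Unitization.inr_nonneg_iff.2 hx
  refine CStarAlgebra.norm_le_norm_of_nonneg_of_le (hma.conjugate_nonneg hX0) ?_
  exact hma.conjugate_le_conjugate ((Unitization.inr_le_iff x y hx.isSelfAdjoint hya).2 hxy)

/-- Perturbing a positive element by at most `r` and raising the cut by `r` goes down in the Cuntz
order. -/
lemma cuntzLE_cutDown_of_norm_sub_le {a b : A} (ha : 0 ≤ a) (hb : 0 ≤ b) {r t : ℝ}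
    (hr : ‖a - b‖ ≤ r) (ht : 0 ≤ t) : CuntzLE (cutDown (t + r) a) (cutDown t b) := by
  have hr0 : 0 ≤ r := (norm_nonneg _).trans hr
  have haa : IsSelfAdjoint a := ha.isSelfAdjoint
  have hba : IsSelfAdjoint b := hb.isSelfAdjoint
  have hAa : IsSelfAdjoint (a : Unitization ℂ A) := haa.inr ℂ
  have hBa : IsSelfAdjoint (b : Unitization ℂ A) := hba.inr ℂ
  have hY : ((cutDown t b : A) : Unitization ℂ A) =
      cfc (fun s => max 0 (s - t)) (b : Unitization ℂ A) :=
    Unitization.real_cfcₙ_eq_cfc_inr b _ (cutDown_fun_zero ht)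
  have hle : (a : Unitization ℂ A) - algebraMap ℝ _ (t + r) ≤ (cutDown t b : A) := by
    have h1 : (a : Unitization ℂ A) - b ≤ algebraMap ℝ _ r := by
      have h := IsSelfAdjoint.le_algebraMap_norm_self (hAa.sub hBa)
      refine h.trans (algebraMap_mono _ ?_)
      rwa [← Unitization.inr_sub, Unitization.norm_inr]
    have h2 : (b : Unitization ℂ A) - algebraMap ℝ _ t ≤ (cutDown t b : A) := by
      rw [hY]
      calc _ = cfc (fun s => s - t) (b : Unitization ℂ A) := by
            rw [cfc_sub _ _ _ (by fun_prop) (by fun_prop), cfc_const t (b : Unitization ℂ A),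
              cfc_id' ℝ (b : Unitization ℂ A)]
        _ ≤ _ := cfc_mono fun s _ => le_max_right _ _
    calc _ = ((a : Unitization ℂ A) - b - algebraMap ℝ _ r) + ((b : Unitization ℂ A) -
        algebraMap ℝ _ t) := by
          rw [map_add]; abel
      _ ≤ 0 + (cutDown t b : A) := add_le_add (sub_nonpos.2 h1) h2
      _ = _ := zero_add _
  refine CuntzLE.of_forall_exists fun ε hε => ?_
  obtain ⟨δ, hδ, hδε⟩ := exists_between hε
  set g : ℝ → ℝ := fun s => min 1 (max 0 (s - (t + r)) / δ) with hg
  have hgc : Continuous g := by fun_prop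
  have h0 := cutDown_fun_zero (add_nonneg ht hr0)
  have hg0 : g 0 = 0 := by simp only [hg, h0]; simp
  have hgn : ∀ s, 0 ≤ g s := fun s => le_min zero_le_one (by positivity)
  have hgsmall : ∀ s, s ≤ t + r → g s = 0 := by
    intro s hs
    simp only [hg]
    rw [max_eq_left (by linarith)]; simp
  set G : A := cfcₙ g a with hG
  have hGa : IsSelfAdjoint G := cfcₙ_predicate g a
  have hG' : (G : Unitization ℂ A) = cfc g (a : Unitization ℂ A) :=
    Unitization.real_cfcₙ_eq_cfc_inr a g hg0
  set fz : ℝ → ℝ := fun s => g s * (s - (t + r)) * g s with hfz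
  have hfz0 : fz 0 = 0 := by simp only [hfz, hg0]; simp
  have hfzn : ∀ s, 0 ≤ fz s := by
    intro s
    rcases le_total s (t + r) with h | h
    · simp only [hfz, hgsmall s h]; simp
    · exact mul_nonneg (mul_nonneg (hgn s) (by linarith)) (hgn s)
  have hfzc : Continuous fz := by fun_prop
  refine ⟨cfcₙ fz a, ?_, ?_⟩
  · refine lt_of_le_of_lt ?_ hδε
    rw [cutDown, ← cfcₙ_sub _ _ _ (by fun_prop) h0 (by fun_prop) hfz0]
    refine norm_cfcₙ_le fun s _ => ?_
    rcases le_total s (t + r) with h | h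
    · simp only [hfz, hgsmall s h]
      rw [max_eq_left (by linarith)]; simpa using hδ.le
    · simp only [hfz, hg]
      rw [max_eq_right (by linarith)]
      set u := s - (t + r)
      have hu : 0 ≤ u := sub_nonneg.2 h
      have hm0 : 0 ≤ min 1 (u / δ) := le_min zero_le_one (by positivity)
      rcases le_total u δ with h' | h'
      · have : min 1 (u / δ) * u * min 1 (u / δ) ≤ u := by
          have := min_le_left 1 (u / δ)
          calc _ ≤ 1 * u * 1 := by gcongr
            _ = u := by ring
        rw [Real.norm_eq_abs, abs_of_nonneg (by linarith)]
        have : 0 ≤ min 1 (u / δ) * u * min 1 (u / δ) := by positivity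
        linarith
      · rw [min_eq_left ((one_le_div hδ).2 h')]
        simpa using hδ.le
  · have hz : ((cfcₙ fz a : A) : Unitization ℂ A)
        = G * ((a : Unitization ℂ A) - algebraMap ℝ _ (t + r)) * G := by
      rw [Unitization.real_cfcₙ_eq_cfc_inr a fz hfz0, hG', hfz,
        cfc_mul _ _ _ (by fun_prop) (by fun_prop), cfc_mul _ _ _ (by fun_prop) (by fun_prop),
        cfc_sub _ _ _ (by fun_prop) (by fun_prop), cfc_const _ (a : Unitization ℂ A),
        cfc_id' ℝ (a : Unitization ℂ A)]
    have hya : IsSelfAdjoint (cutDown t b) := cfcₙ_predicate _ _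
    have hGyG : IsSelfAdjoint (G * cutDown t b * G) := by
      simpa [hGa.star_eq] using hya.conjugate G
    refine (cuntzLE_of_le (y := G * cutDown t b * G) (cfcₙ_nonneg fun s _ => hfzn s) ?_).trans ?_
    · rw [← Unitization.inr_le_iff _ _ (cfcₙ_predicate _ _) hGyG, hz]
      simp only [Unitization.inr_mul]
      exact (hGa.inr ℂ).conjugate_le_conjugate hle
    · exact cuntzLE_iff.2 fun ε hε => ⟨G, by simpa [hGa.star_eq] using hε⟩

lemma cutDown_eq_zero {a : A} (ha : 0 ≤ a) {s : ℝ} (hs : ‖a‖ ≤ s) : cutDown s a = 0 := by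
  rw [cutDown, ← cfcₙ_zero ℝ a]
  refine cfcₙ_congr fun t ht => ?_
  have haa : IsSelfAdjoint a := ha.isSelfAdjoint
  have h := norm_apply_le_norm_cfcₙ (fun x : ℝ => x) a ht
  rw [cfcₙ_id' ℝ a] at h
  have := (le_abs_self t).trans h
  simp only [Pi.zero_apply, max_eq_left_iff]
  linarith

lemma bddBelow_dW_set (a b : A) : BddBelow {r : ℝ | 0 < r ∧ ∀ t : ℝ, 0 < t →
    CuntzLE (cutDown (t + r) a) (cutDown t b) ∧ CuntzLE (cutDown (t + r) b) (cutDown t a)} :=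
  ⟨0, fun _ hr => hr.1.le⟩

lemma nonempty_dW_set {a b : A} (ha : 0 ≤ a) (hb : 0 ≤ b) : {r : ℝ | 0 < r ∧ ∀ t : ℝ, 0 < t →
    CuntzLE (cutDown (t + r) a) (cutDown t b) ∧
      CuntzLE (cutDown (t + r) b) (cutDown t a)}.Nonempty := by
  refine ⟨‖a‖ + ‖b‖ + 1, by positivity, fun t ht => ?_⟩
  have h1 : cutDown (t + (‖a‖ + ‖b‖ + 1)) a = 0 := cutDown_eq_zero ha (by linarith [norm_nonneg b])
  have h2 : cutDown (t + (‖a‖ + ‖b‖ + 1)) b = 0 := cutDown_eq_zero hb (by linarith [norm_nonneg a])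
  rw [h1, h2]
  exact ⟨cuntzLE_zero _, cuntzLE_zero _⟩

omit [PartialOrder A] [StarOrderedRing A] in
lemma bddBelow_dU_range (a b : A) : BddBelow (Set.range fun u : unitary (Unitization ℂ A) =>
    ‖(u : Unitization ℂ A) * (a : Unitization ℂ A) * star (u : Unitization ℂ A)
      - (b : Unitization ℂ A)‖) :=
  ⟨0, by rintro _ ⟨u, rfl⟩; exact norm_nonneg _⟩

/-- Conjugation by a unitary of the unitisation preserves the Cuntz classes of cut-downs, so
`dW` is dominated by `dU` in every C⋆-algebra. -/
lemma dW_le_dU {a b : A} (ha : 0 ≤ a) (hb : 0 ≤ b) : dW a b ≤ dU a b := by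
  refine le_ciInf fun u => le_of_forall_gt_imp_ge_of_dense fun r hr => ?_
  obtain ⟨c, hc⟩ : ∃ c : A, (c : Unitization ℂ A) = u * (a : Unitization ℂ A) *
      star (u : Unitization ℂ A) := by
    refine ⟨((u : Unitization ℂ A) * a * star (u : Unitization ℂ A)).snd, ?_⟩
    ext <;> simp
  have haa : IsSelfAdjoint a := ha.isSelfAdjoint
  have hc0 : 0 ≤ c := by
    rw [← Unitization.inr_nonneg_iff, hc]
    exact star_right_conjugate_nonneg (Unitization.inr_nonneg_iff.2 ha) _
  have hcut : ∀ s, 0 ≤ s → ((cutDown s c : A) : Unitization ℂ A) =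
      u * (cutDown s a : A) * star (u : Unitization ℂ A) := by
    intro s hs
    rw [cutDown, cutDown, Unitization.real_cfcₙ_eq_cfc_inr _ _ (cutDown_fun_zero hs),
      Unitization.real_cfcₙ_eq_cfc_inr _ _ (cutDown_fun_zero hs), hc]
    have := StarAlgHomClass.map_cfc (S := ℝ) (Unitary.conjStarAlgAut ℝ _ u) (fun t => max 0 (t - s))
      (a : Unitization ℂ A) (by fun_prop) ?_ (haa.inr ℂ) ?_
    · simpa [Unitary.conjStarAlgAut_apply] using this.symm
    · have : Continuous fun x : Unitization ℂ A => (u : Unitization ℂ A) * x *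
        star (u : Unitization ℂ A) := by
        fun_prop
      exact this
    · exact (haa.inr ℂ).conjugate (u : Unitization ℂ A)
  have hcn : ‖c - b‖ ≤ r := by
    rw [← Unitization.norm_inr (𝕜 := ℂ), Unitization.inr_sub, hc]; exact hr.le
  have hpos : 0 < r := (norm_nonneg _).trans_lt hr
  refine csInf_le (bddBelow_dW_set a b) ⟨hpos, fun t ht => ⟨?_, ?_⟩⟩
  · refine CuntzLE.trans ?_ (cuntzLE_cutDown_of_norm_sub_le hc0 hb hcn ht.le)
    refine CuntzLE.of_inr_eq (star (u : Unitization ℂ A)) (cfcₙ_predicate _ _) ?_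
    rw [hcut _ (by positivity)]
    simp only [mul_assoc, star_star, Unitary.coe_star_mul_self, mul_one]
    rw [← mul_assoc, Unitary.coe_star_mul_self, one_mul]
  · refine (cuntzLE_cutDown_of_norm_sub_le hb hc0 (by rwa [norm_sub_rev]) ht.le).trans ?_
    exact CuntzLE.of_inr_eq (u : Unitization ℂ A) (cfcₙ_predicate _ _) (hcut _ ht.le)

end CutDown

/-! ### Matching of spectral data -/

section Sorting

variable {ι : Type*} [Fintype ι]

/-- Comonotone families can be sorted simultaneously. -/
lemma Monovary.exists_equiv_monotone {D E : ι → ℝ} (h : Monovary D E) :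
    ∃ e : Fin (Fintype.card ι) ≃ ι, Monotone (D ∘ e) ∧ Monotone (E ∘ e) := by
  let e₀ := (Fintype.equivFin ι).symm
  let f : Fin (Fintype.card ι) → ℝ ×ₗ ℝ := fun i => toLex (E (e₀ i), D (e₀ i))
  have hf := Tuple.monotone_sort f
  refine ⟨(Tuple.sort f).trans e₀, fun i j hij => ?_, fun i j hij => ?_⟩
  · have := Prod.Lex.le_iff.1 (hf hij)
    rcases this with h1 | h1
    · exact h h1
    · exact h1.2
  · have := Prod.Lex.le_iff.1 (hf hij)
    rcases this with h1 | h1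
    · exact h1.le
    · exact h1.1.le

lemma Monotone.eq_of_multiset_map_eq {m : ℕ} {f g : Fin m → ℝ} (hf : Monotone f) (hg : Monotone g)
    (h : Finset.univ.val.map f = Finset.univ.val.map g) : f = g := by
  refine List.ofFn_injective (List.Perm.eq_of_sortedLE hf.sortedLE_ofFn hg.sortedLE_ofFn ?_)
  simpa [Fin.univ_val_map] using h

lemma multiset_map_comp_equiv {κ : Type*} [Fintype κ] (e : κ ≃ ι) (f : ι → ℝ) :
    Finset.univ.val.map (f ∘ e) = Finset.univ.val.map f := by
  rw [← Multiset.map_map]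
  congr 1
  simp

/-- Two comonotone pairs of families with the same values, counted with multiplicity, differ by a
single permutation. -/
lemma Monovary.exists_perm_of_multiset_map_eq {D E D' E' : ι → ℝ} (h : Monovary D E)
    (h' : Monovary D' E') (hD : Finset.univ.val.map D = Finset.univ.val.map D')
    (hE : Finset.univ.val.map E = Finset.univ.val.map E') :
    ∃ τ : Equiv.Perm ι, D' = D ∘ τ ∧ E' = E ∘ τ := by
  obtain ⟨e, he1, he2⟩ := h.exists_equiv_monotone
  obtain ⟨e', he1', he2'⟩ := h'.exists_equiv_monotone
  have h1 : D ∘ e = D' ∘ e' := he1.eq_of_multiset_map_eq he1' (by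
    rw [multiset_map_comp_equiv, multiset_map_comp_equiv, hD])
  have h2 : E ∘ e = E' ∘ e' := he2.eq_of_multiset_map_eq he2' (by
    rw [multiset_map_comp_equiv, multiset_map_comp_equiv, hE])
  refine ⟨e'.symm.trans e, ?_, ?_⟩
  · funext i
    simpa using (congrFun h1 (e'.symm i)).symm
  · funext i
    simpa using (congrFun h2 (e'.symm i)).symm

lemma exists_equiv_monotone (D : ι → ℝ) :
    ∃ e : Fin (Fintype.card ι) ≃ ι, Monotone (D ∘ e) := by
  obtain ⟨e, he, -⟩ := (monovary_self D).exists_equiv_monotone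
  exact ⟨e, he⟩

lemma le_add_of_card_le {m : ℕ} {f g : Fin m → ℝ} (hf : Monotone f) (hg : Monotone g)
    (hg0 : ∀ i, 0 ≤ g i) {r : ℝ}
    (h : ∀ s : ℝ, 0 < s → Fintype.card {i // s + r < f i} ≤ Fintype.card {i // s < g i})
    (i : Fin m) : f i ≤ g i + r := by
  by_contra! hlt
  obtain ⟨s, hs1, hs2⟩ := exists_between (show g i < f i - r by linarith)
  have h1 := h s ((hg0 i).trans_lt hs1)
  rw [Fintype.card_subtype, Fintype.card_subtype] at h1
  have h2 : (Finset.univ.filter fun j => s < g j) ⊆ Finset.Ioi i := by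
    intro j hj
    simp only [Finset.mem_filter, Finset.mem_univ, true_and] at hj
    rw [Finset.mem_Ioi]
    by_contra! hji
    linarith [hg hji]
  have h3 : Finset.Ici i ⊆ (Finset.univ.filter fun j => s + r < f j) := by
    intro j hj
    simp only [Finset.mem_filter, Finset.mem_univ, true_and]
    linarith [hf (Finset.mem_Ici.1 hj)]
  have := (Finset.card_le_card h3).trans (h1.trans (Finset.card_le_card h2))
  rw [Fin.card_Ici, Fin.card_Ioi] at this
  have := i.2
  omega

/-- If the counting functions of two families are within `r`, then their monotone rearrangements
are within `r`. -/
lemma exists_perm_monovary_of_card_le {D E : ι → ℝ} (hD : ∀ i, 0 ≤ D i) (hE : ∀ i, 0 ≤ E i) {r : ℝ}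
    (h1 : ∀ s : ℝ, 0 < s → Fintype.card {i // s + r < D i} ≤ Fintype.card {i // s < E i})
    (h2 : ∀ s : ℝ, 0 < s → Fintype.card {i // s + r < E i} ≤ Fintype.card {i // s < D i}) :
    ∃ τ : Equiv.Perm ι, Monovary D (E ∘ τ) ∧ ∀ i, |D i - E (τ i)| ≤ r := by
  obtain ⟨e, he⟩ := exists_equiv_monotone D
  obtain ⟨e', he'⟩ := exists_equiv_monotone E
  have hc : ∀ (F : ι → ℝ) (e : Fin (Fintype.card ι) ≃ ι) (s : ℝ),
      Fintype.card {i // s < F i} = Fintype.card {i // s < (F ∘ e) i} := fun F e s =>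
    Fintype.card_congr (e.symm.subtypeEquiv fun i => by simp)
  refine ⟨e.symm.trans e', fun i j hij => ?_, fun i => ?_⟩
  · have : e.symm i < e.symm j := by
      by_contra! hji
      exact absurd hij (not_lt.2 (he' hji))
    simpa using he this.le
  · have a1 := le_add_of_card_le he he' (fun i => hE _) (r := r) (by
      intro s hs; rw [← hc, ← hc]; exact h1 s hs) (e.symm i)
    have a2 := le_add_of_card_le he' he (fun i => hD _) (r := r) (by
      intro s hs; rw [← hc, ← hc]; exact h2 s hs) (e.symm i)
    simp only [Function.comp_apply, Equiv.apply_symm_apply] at a1 a2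
    rw [abs_le]
    constructor <;> simp <;> linarith

end Sorting

section Logarithm

open Complex selfAdjoint Unitary in
/-- The principal logarithm of a unitary, provided the argument is continuous on the spectrum. -/
lemma expUnitary_argSelfAdjoint_of_continuousOn {A : Type*} [CStarAlgebra A] {u : unitary A}
    (hu : ContinuousOn Complex.arg (spectrum ℂ (u : A))) :
    expUnitary (argSelfAdjoint u) = u := by
  ext
  rw [expUnitary_coe, argSelfAdjoint_coe, ← CFC.exp_eq_normedSpace_exp (𝕜 := ℂ),
    ← cfc_comp_smul .., ← cfc_comp' ..]
  conv_rhs => rw [← cfc_id' ℂ (u : A)]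
  refine cfc_congr fun y hy ↦ ?_
  have hy₁ : ‖y‖ = 1 := spectrum.norm_eq_one_of_unitary u.2 hy
  have : Complex.I * y.arg = log y :=
    Complex.ext (by simp [log_re, spectrum.norm_eq_one_of_unitary u.2 hy]) (by simp [log_im])
  simpa [← exp_eq_exp_ℂ, this] using exp_log (by aesop)

end Logarithm

section Matrices

variable {ι : Type*} [Fintype ι] [DecidableEq ι]

/-- The complex diagonal matrix with real diagonal `D`. -/
def dg (D : ι → ℝ) : Matrix ι ι ℂ := Matrix.diagonal fun i => (D i : ℂ)

omit [Fintype ι] in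
@[fun_prop]
lemma continuous_dg : Continuous (dg : (ι → ℝ) → Matrix ι ι ℂ) := by
  unfold dg
  fun_prop

omit [Fintype ι] in
lemma dg_sub (D E : ι → ℝ) : dg D - dg E = dg (D - E) := by
  simp [dg, Matrix.diagonal_sub]

lemma norm_dg_le {D : ι → ℝ} {r : ℝ} (hr : 0 ≤ r) (h : ∀ i, |D i| ≤ r) : ‖dg D‖ ≤ r := by
  rw [dg, Matrix.l2_opNorm_diagonal, pi_norm_le_iff_of_nonneg hr]
  simpa using h

/-- The unitary group of a finite matrix algebra is compact. -/
instance compactSpace_unitary_matrix : CompactSpace (unitary (Matrix ι ι ℂ)) := by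
  refine isCompact_iff_compactSpace.1 (?_ : IsCompact (unitary (Matrix ι ι ℂ) : Set (Matrix ι ι ℂ)))
  have : ProperSpace (Matrix ι ι ℂ) := FiniteDimensional.proper ℂ _
  refine Metric.isCompact_of_isClosed_isBounded ?_ ?_
  · have : ((unitary (Matrix ι ι ℂ) : Submonoid (Matrix ι ι ℂ)) : Set (Matrix ι ι ℂ)) =
        {u | star u * u = 1} ∩ {u | u * star u = 1} := by
      ext u; simp [Unitary.mem_iff]
    rw [this]
    exact (isClosed_eq (by fun_prop) continuous_const).inter
      (isClosed_eq (by fun_prop) continuous_const)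
  · refine (Metric.isBounded_closedBall (x := (0 : Matrix ι ι ℂ)) (r := 1)).subset fun u hu => ?_
    rw [mem_closedBall_zero_iff]
    rcases subsingleton_or_nontrivial (Matrix ι ι ℂ) with h | h
    · rw [Subsingleton.elim u 0]; simp
    · exact (CStarRing.norm_of_mem_unitary hu).le

/-- The eigenvalues in a unitary diagonalisation are determined up to order. -/
lemma multiset_map_eq_of_conj_dg {x x' : unitary (Matrix ι ι ℂ)} {D D' : ι → ℝ}
    (h : (x : Matrix ι ι ℂ) * dg D * star (x : Matrix ι ι ℂ)
      = (x' : Matrix ι ι ℂ) * dg D' * star (x' : Matrix ι ι ℂ)) :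
    Finset.univ.val.map D = Finset.univ.val.map D' := by
  have key : ∀ (x : unitary (Matrix ι ι ℂ)) (D : ι → ℝ),
      ((x : Matrix ι ι ℂ) * dg D * star (x : Matrix ι ι ℂ)).charpoly.roots =
        Finset.univ.val.map fun i => (D i : ℂ) := by
    intro x D
    have h : ∏ i, (Polynomial.X - Polynomial.C (D i : ℂ)) =
        ((Finset.univ.val.map fun i => (D i : ℂ)).map fun z =>
          Polynomial.X - Polynomial.C z).prod := by
      rw [Multiset.map_map]; rfl
    rw [Matrix.charpoly_mul_comm, ← mul_assoc, Unitary.coe_star_mul_self, one_mul, dg,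
      Matrix.charpoly_diagonal, h, Polynomial.roots_multiset_prod_X_sub_C]
  have := (key x D).symm.trans ((congrArg (fun M => M.charpoly.roots) h).trans (key x' D'))
  have h2 := congrArg (Multiset.map Complex.re) this
  simpa using h2

/-- Permuting the columns of a unitary matrix. -/
def permCols (x : unitary (Matrix ι ι ℂ)) (τ : Equiv.Perm ι) : unitary (Matrix ι ι ℂ) :=
  ⟨(x : Matrix ι ι ℂ).submatrix id τ, by
    have h1 : ((x : Matrix ι ι ℂ).submatrix id τ)ᴴ = ((x : Matrix ι ι ℂ)ᴴ).submatrix τ id := rfl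
    rw [Unitary.mem_iff, Matrix.star_eq_conjTranspose, h1]
    constructor
    · rw [← Matrix.submatrix_mul _ _ τ id τ Function.bijective_id]
      rw [← Matrix.star_eq_conjTranspose, Unitary.coe_star_mul_self, Matrix.submatrix_one_equiv]
    · rw [Matrix.submatrix_mul_equiv, ← Matrix.star_eq_conjTranspose,
        Unitary.mul_star_self_of_mem x.2]
      simp⟩

lemma permCols_mul_star (x y : unitary (Matrix ι ι ℂ)) (τ : Equiv.Perm ι) :
    (permCols y τ : Matrix ι ι ℂ) * star (permCols x τ : Matrix ι ι ℂ)
      = (y : Matrix ι ι ℂ) * star (x : Matrix ι ι ℂ) := by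
  change (y : Matrix ι ι ℂ).submatrix id τ * ((x : Matrix ι ι ℂ)ᴴ).submatrix τ id = _
  rw [Matrix.submatrix_mul_equiv]
  simp [Matrix.star_eq_conjTranspose]

lemma permCols_conj_dg (x : unitary (Matrix ι ι ℂ)) (τ : Equiv.Perm ι) (D : ι → ℝ) :
    (permCols x τ : Matrix ι ι ℂ) * dg (D ∘ τ) * star (permCols x τ : Matrix ι ι ℂ)
      = (x : Matrix ι ι ℂ) * dg D * star (x : Matrix ι ι ℂ) := by
  have h : dg (D ∘ τ) = (dg D).submatrix τ τ := by
    rw [dg, dg, Matrix.submatrix_diagonal_equiv]; rfl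
  change (x : Matrix ι ι ℂ).submatrix id τ * _ * ((x : Matrix ι ι ℂ)ᴴ).submatrix τ id = _
  rw [h, Matrix.submatrix_mul_equiv, Matrix.submatrix_mul_equiv]
  simp [Matrix.star_eq_conjTranspose]

/-- A unitary matrix that commutes with a selfadjoint matrix `d` is joined to `1` by unitaries
commuting with `d`: as the spectrum of the unitary is finite, it has a logarithm by continuous
functional calculus. -/
lemma joinedIn_one_of_commute {d : Matrix ι ι ℂ} (hd : IsSelfAdjoint d) (z : unitary (Matrix ι ι ℂ))
    (hz : Commute (z : Matrix ι ι ℂ) d) :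
    JoinedIn {w : unitary (Matrix ι ι ℂ) | Commute (w : Matrix ι ι ℂ) d} 1 z := by
  set h : selfAdjoint (Matrix ι ι ℂ) := Unitary.argSelfAdjoint z with hh
  have hfin : (spectrum ℂ (z : Matrix ι ι ℂ)).Finite := Matrix.finite_spectrum _
  have hexp : selfAdjoint.expUnitary h = z :=
    expUnitary_argSelfAdjoint_of_continuousOn (hfin.continuousOn _)
  have hcomm : Commute (h : Matrix ι ι ℂ) d := by
    rw [hh, Unitary.argSelfAdjoint_coe]
    have hz' : Commute (star (z : Matrix ι ι ℂ)) d := by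
      have := hz.star_star
      rwa [hd.star_eq] at this
    exact Commute.cfc hz hz' _
  refine ⟨(selfAdjoint.expUnitaryPathToOne h).cast rfl hexp.symm, fun t => ?_⟩
  simp only [Path.cast_coe, selfAdjoint.expUnitaryPathToOne_apply, Set.mem_ofPred_eq,
    selfAdjoint.expUnitary_coe]
  refine Commute.exp_left ?_
  rw [selfAdjoint.val_smul]
  exact (hcomm.smul_left _).smul_left _

/-- `Matching r R a b u`: the unitary `u` carries an eigenbasis of `a` to an eigenbasis of `b` in
such a way that the eigenvalues, which lie in `[0, R]`, are comonotone and within `r`. -/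
def Matching (r R : ℝ) (a b : Matrix ι ι ℂ) (u : unitary (Matrix ι ι ℂ)) : Prop :=
  ∃ (x y : unitary (Matrix ι ι ℂ)) (D E : ι → ℝ), Monovary D E ∧ (∀ i, D i ∈ Set.Icc 0 R) ∧
    (∀ i, E i ∈ Set.Icc 0 R) ∧ (∀ i, |D i - E i| ≤ r) ∧
    a = (x : Matrix ι ι ℂ) * dg D * star (x : Matrix ι ι ℂ) ∧
    b = (y : Matrix ι ι ℂ) * dg E * star (y : Matrix ι ι ℂ) ∧ u = y * star x

lemma norm_unitary_conj (y : unitary (Matrix ι ι ℂ)) (m : Matrix ι ι ℂ) :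
    ‖(y : Matrix ι ι ℂ) * m * star (y : Matrix ι ι ℂ)‖ = ‖m‖ := by
  rw [← Unitary.coe_star, CStarRing.norm_mul_coe_unitary, CStarRing.norm_coe_unitary_mul]

omit [Fintype ι] [DecidableEq ι] in
lemma isClosed_monovary : IsClosed {p : (ι → ℝ) × (ι → ℝ) | Monovary p.1 p.2} := by
  have : {p : (ι → ℝ) × (ι → ℝ) | Monovary p.1 p.2} =
      ⋂ i, ⋂ j, ({p | p.2 j ≤ p.2 i} ∪ {p | p.1 i ≤ p.1 j}) := by
    ext p
    simp only [Monovary, Set.mem_ofPred_eq, Set.mem_iInter, Set.mem_union]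
    refine forall_congr' fun i => forall_congr' fun j => ?_
    rw [imp_iff_not_or, not_lt]
  rw [this]
  refine isClosed_iInter fun i => isClosed_iInter fun j => IsClosed.union ?_ ?_
  · exact isClosed_le (by fun_prop) (by fun_prop)
  · exact isClosed_le (by fun_prop) (by fun_prop)

/-- The relation `Matching` is compact, being the continuous image of the compact set of all
spectral data. -/
lemma isCompact_matching (r R : ℝ) :
    IsCompact {p : Matrix ι ι ℂ × Matrix ι ι ℂ × unitary (Matrix ι ι ℂ) |
      Matching r R p.1 p.2.1 p.2.2} := by
  let S : Set ((unitary (Matrix ι ι ℂ) × unitary (Matrix ι ι ℂ)) × (ι → ℝ) × (ι → ℝ)) :=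
    Set.univ ×ˢ ((Set.univ.pi (fun _ => Set.Icc 0 R) ×ˢ Set.univ.pi (fun _ => Set.Icc 0 R)) ∩
      ({p | Monovary p.1 p.2} ∩ {p | ∀ i, |p.1 i - p.2 i| ≤ r}))
  have hS : IsCompact S := by
    refine isCompact_univ.prod (IsCompact.inter_right ?_ (isClosed_monovary.inter ?_))
    · exact (isCompact_univ_pi fun _ => isCompact_Icc).prod
        (isCompact_univ_pi fun _ => isCompact_Icc)
    · simp only [Set.ofPred_forall]
      exact isClosed_iInter fun i => isClosed_le (by fun_prop) (by fun_prop)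
  let Φ : ((unitary (Matrix ι ι ℂ) × unitary (Matrix ι ι ℂ)) × (ι → ℝ) × (ι → ℝ)) →
      Matrix ι ι ℂ × Matrix ι ι ℂ × unitary (Matrix ι ι ℂ) := fun q =>
    ((q.1.1 : Matrix ι ι ℂ) * dg q.2.1 * star (q.1.1 : Matrix ι ι ℂ),
      (q.1.2 : Matrix ι ι ℂ) * dg q.2.2 * star (q.1.2 : Matrix ι ι ℂ), q.1.2 * star q.1.1)
  have hΦ : Continuous Φ := by fun_prop
  convert hS.image hΦ using 1
  ext ⟨a, b, u⟩
  constructor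
  · rintro ⟨x, y, D, E, h1, h2, h3, h4, h5, h6, h7⟩
    exact ⟨((x, y), (D, E)), ⟨trivial, ⟨fun i _ => h2 i, fun i _ => h3 i⟩, h1, h4⟩,
      Prod.ext h5.symm (Prod.ext h6.symm h7.symm)⟩
  · rintro ⟨⟨⟨x, y⟩, D, E⟩, ⟨-, ⟨h2, h3⟩, h1, h4⟩, h⟩
    exact ⟨x, y, D, E, h1, fun i => h2 i trivial, fun i => h3 i trivial, h4,
      (congrArg Prod.fst h).symm, (congrArg (fun p => p.2.1) h).symm,
      (congrArg (fun p => p.2.2) h).symm⟩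

/-- Any two matching unitaries are joined through unitaries `v` with `‖v a v⋆ - b‖ ≤ r`: after a
permutation of eigenvectors they differ by unitaries commuting with the diagonal matrices. -/
lemma Matching.joinedIn {r R : ℝ} {a b : Matrix ι ι ℂ} (hr : 0 ≤ r) {u u' : unitary (Matrix ι ι ℂ)}
    (hu : Matching r R a b u) (hu' : Matching r R a b u') :
    JoinedIn {v : unitary (Matrix ι ι ℂ) |
      ‖(v : Matrix ι ι ℂ) * a * star (v : Matrix ι ι ℂ) - b‖ ≤ r} u u' := by
  obtain ⟨x, y, D, E, h1, h2, h3, h4, h5, h6, h7⟩ := hu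
  obtain ⟨x', y', D', E', h1', h2', h3', h4', h5', h6', h7'⟩ := hu'
  obtain ⟨τ, hτD, hτE⟩ := h1'.exists_perm_of_multiset_map_eq h1
    (multiset_map_eq_of_conj_dg (h5'.symm.trans h5))
    (multiset_map_eq_of_conj_dg (h6'.symm.trans h6))
  have hx'' := permCols_conj_dg x' τ D'
  have hy'' := permCols_conj_dg y' τ E'
  have hu'' := permCols_mul_star x' y' τ
  set x'' := permCols x' τ
  set y'' := permCols y' τ
  rw [← hτD, ← h5'] at hx''
  rw [← hτE, ← h6'] at hy''
  have hcomm : ∀ (x x'' : unitary (Matrix ι ι ℂ)) (d a : Matrix ι ι ℂ),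
      a = (x : Matrix ι ι ℂ) * d * star (x : Matrix ι ι ℂ) →
      (x'' : Matrix ι ι ℂ) * d * star (x'' : Matrix ι ι ℂ) = a →
      Commute ((star x * x'' : unitary (Matrix ι ι ℂ)) : Matrix ι ι ℂ) d := by
    intro x x'' d a ha ha''
    have e := ha''.trans ha
    have e2 : star (x : Matrix ι ι ℂ) * ((x'' : Matrix ι ι ℂ) * d * star (x'' : Matrix ι ι ℂ)) * x''
        = star (x : Matrix ι ι ℂ) * ((x : Matrix ι ι ℂ) * d * star (x : Matrix ι ι ℂ)) * x'' :=
            by rw [e]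
    simp only [mul_assoc, Unitary.coe_star_mul_self, mul_one] at e2
    rw [← mul_assoc (star (x : Matrix ι ι ℂ)) (x : Matrix ι ι ℂ), Unitary.coe_star_mul_self,
        one_mul] at e2
    change star (x : Matrix ι ι ℂ) * (x'' : Matrix ι ι ℂ) * d =
        d * (star (x : Matrix ι ι ℂ) * (x'' : Matrix ι ι ℂ))
    rw [mul_assoc, e2]
  have hdg : ∀ D : ι → ℝ, IsSelfAdjoint (dg D) := by
    intro D
    rw [IsSelfAdjoint, Matrix.star_eq_conjTranspose, dg, Matrix.diagonal_conjTranspose]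
    congr 1
    ext i; simp
  obtain ⟨γ, hγ⟩ := joinedIn_one_of_commute (hdg D) _ (hcomm x x'' _ _ h5 hx'')
  obtain ⟨δ, hδ⟩ := joinedIn_one_of_commute (hdg E) _ (hcomm y y'' _ _ h6 hy'')
  refine ⟨⟨⟨fun t => y * δ t * star (γ t) * star x, by fun_prop⟩, by simp [h7], ?_⟩, fun t => ?_⟩
  · simp only [Path.target, star_mul, star_star]
    have : u' = y'' * star x'' := by
      rw [h7']; exact Subtype.ext hu''.symm
    rw [this]
    simp only [mul_assoc, Unitary.mul_star_self, mul_one]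
    rw [← mul_assoc y (star y), Unitary.mul_star_self, one_mul]
  · simp only [Path.coe_mk_mk, Set.mem_ofPred_eq, Submonoid.coe_mul, star_mul, Unitary.coe_star,
      star_star]
    have c1 : star (γ t : Matrix ι ι ℂ) * dg D * (γ t : Matrix ι ι ℂ) = dg D := by
      have := hγ t
      rw [mul_assoc, ← Commute.eq this, ← mul_assoc, Unitary.coe_star_mul_self, one_mul]
    have c2 : (δ t : Matrix ι ι ℂ) * dg E * star (δ t : Matrix ι ι ℂ) = dg E := by
      have := hδ t
      rw [Commute.eq this, mul_assoc, Unitary.mul_star_self_of_mem (δ t).2, mul_one]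
    have e : (y : Matrix ι ι ℂ) * (δ t : Matrix ι ι ℂ) * star (γ t : Matrix ι ι ℂ) *
        star (x : Matrix ι ι ℂ) * a *
        ((x : Matrix ι ι ℂ) * ((γ t : Matrix ι ι ℂ) * (star (δ t : Matrix ι ι ℂ) *
            star (y : Matrix ι ι ℂ)))) - b
        = (y : Matrix ι ι ℂ) * ((δ t : Matrix ι ι ℂ) * (dg D - dg E) * star (δ t : Matrix ι ι ℂ)) *
          star (y : Matrix ι ι ℂ) := by
      have e1 : star (x : Matrix ι ι ℂ) * a * (x : Matrix ι ι ℂ) = dg D := by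
        rw [h5]
        simp only [mul_assoc, Unitary.coe_star_mul_self, mul_one]
        rw [← mul_assoc, Unitary.coe_star_mul_self, one_mul]
      rw [mul_sub, sub_mul, c2, mul_sub, sub_mul, ← h6]
      congr 1
      calc _ = (y : Matrix ι ι ℂ) * (δ t : Matrix ι ι ℂ) * (star (γ t : Matrix ι ι ℂ) *
          (star (x : Matrix ι ι ℂ) * a *
        (x : Matrix ι ι ℂ)) * (γ t : Matrix ι ι ℂ)) * (star (δ t : Matrix ι ι ℂ) *
            star (y : Matrix ι ι ℂ)) := by
            simp only [mul_assoc]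
        _ = _ := by rw [e1, c1]; simp only [mul_assoc]
    rw [e, norm_unitary_conj, norm_unitary_conj, dg_sub]
    exact norm_dg_le hr h4

end Matrices

/-! ### Continuous selection of matching unitaries over the interval -/

section Paths

variable {ι : Type*} [Fintype ι] [DecidableEq ι]

lemma joinedIn_ball_of_dist_lt {u w : unitary (Matrix ι ι ℂ)} {η : ℝ} (hη : 0 < η)
    (hη2 : η < 2) (h : dist u w < η) : JoinedIn (Metric.ball w η) u w :=
  (Unitary.isPathConnected_ball w η hη hη2).joinedIn u h w (Metric.mem_ball_self hη)

/-- Near a point `s` of the interval all matching unitaries are joined through a set of unitaries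
that almost match throughout a neighbourhood of `s`. -/
lemma exists_nhds_joinedIn_matching {a b : I → Matrix ι ι ℂ} (ha : Continuous a) (hb : Continuous b)
    {r R ε : ℝ} (hr : 0 ≤ r) (hε : 0 < ε) (s : I) :
    ∃ N : Set I, IsOpen N ∧ s ∈ N ∧ ∃ V : Set (unitary (Matrix ι ι ℂ)),
      (∀ t ∈ N, ∀ v ∈ V, ‖(v : Matrix ι ι ℂ) * a t * star (v : Matrix ι ι ℂ) - b t‖ < r + ε) ∧
      ∀ t₁ ∈ N, ∀ t₂ ∈ N, ∀ u₁ u₂, Matching r R (a t₁) (b t₁) u₁ → Matching r R (a t₂) (b t₂) u₂ →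
        JoinedIn V u₁ u₂ := by
  set G : Set (unitary (Matrix ι ι ℂ)) :=
    {v | ‖(v : Matrix ι ι ℂ) * a s * star (v : Matrix ι ι ℂ) - b s‖ ≤ r} with hG
  have hGc : IsCompact G := (isClosed_le (by fun_prop) continuous_const).isCompact
  have hopen : IsOpen {p : I × unitary (Matrix ι ι ℂ) |
      ‖(p.2 : Matrix ι ι ℂ) * a p.1 * star (p.2 : Matrix ι ι ℂ) - b p.1‖ < r + ε} :=
    isOpen_lt (by fun_prop) continuous_const
  obtain ⟨N₁, V, hN₁, hV, hsN₁, hGV, hsub⟩ := generalized_tube_lemma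
    (isCompact_singleton (x := s)) hGc hopen (by
    rintro ⟨t, v⟩ ⟨ht, hv⟩
    simp only [Set.mem_singleton_iff] at ht
    subst ht
    simp only [hG, Set.mem_ofPred_eq] at hv ⊢
    linarith)
  obtain ⟨η, hη, hηV⟩ := hGc.exists_thickening_subset_open hV hGV
  obtain ⟨η', hη', hη'2⟩ : ∃ η' : ℝ, 0 < η' ∧ η' ≤ η ∧ η' < 2 :=
    ⟨min η 1, by positivity, min_le_left _ _, (min_le_right _ _).trans_lt (by norm_num)⟩
  set K : Set (unitary (Matrix ι ι ℂ)) := {u | Matching r R (a s) (b s) u} with hK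
  have hKG : K ⊆ G := fun u hu => (Matching.joinedIn hr hu hu).source_mem
  -- by compactness, matching unitaries at nearby points lie close to matching unitaries at `s`
  set F : Set (I × unitary (Matrix ι ι ℂ)) :=
    {p | Matching r R (a p.1) (b p.1) p.2} ∩ {p | p.2 ∉ Metric.thickening η' K} with hF
  have hFc : IsClosed F := by
    refine IsClosed.inter ?_ ?_
    · exact (isCompact_matching r R).isClosed.preimage
        (f := fun p : I × unitary (Matrix ι ι ℂ) => (a p.1, b p.1, p.2)) (by fun_prop)
    · exact (Metric.isOpen_thickening.preimage continuous_snd).isClosed_compl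
  have hproj : IsClosed (Prod.fst '' F) := isClosedMap_fst_of_compactSpace _ hFc
  have hsF : s ∉ Prod.fst '' F := by
    rintro ⟨⟨t, u⟩, ⟨h1, h2⟩, rfl⟩
    exact h2 (Metric.self_subset_thickening hη' _ h1)
  have near : ∀ t ∉ Prod.fst '' F, ∀ u, Matching r R (a t) (b t) u → ∃ w ∈ K, JoinedIn V u w := by
    intro t ht u hu
    have : u ∈ Metric.thickening η' K := by
      by_contra h
      exact ht ⟨(t, u), ⟨hu, h⟩, rfl⟩
    obtain ⟨w, hw, huw⟩ := Metric.mem_thickening_iff.1 this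
    refine ⟨w, hw, ?_⟩
    have h1 : JoinedIn (Metric.ball w η') u w := joinedIn_ball_of_dist_lt hη' hη'2.2 huw
    have h2 : Metric.ball w η' ⊆ V := by
      intro v hv
      have h3 : v ∈ Metric.thickening η G :=
        Metric.mem_thickening_iff.2 ⟨w, hKG hw, lt_of_lt_of_le (Metric.mem_ball.1 hv) hη'2.1⟩
      exact hηV h3
    exact h1.mono h2
  refine ⟨N₁ ∩ (Prod.fst '' F)ᶜ, hN₁.inter hproj.isOpen_compl, ⟨hsN₁ rfl, hsF⟩, V, ?_, ?_⟩
  · intro t ht v hv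
    have h := hsub (show (t, v) ∈ N₁ ×ˢ V from ⟨ht.1, hv⟩)
    rw [Set.mem_ofPred_eq] at h
    exact h
  · intro t₁ ht₁ t₂ ht₂ u₁ u₂ hu₁ hu₂
    obtain ⟨w₁, hw₁, h₁⟩ := near t₁ ht₁.2 u₁ hu₁
    obtain ⟨w₂, hw₂, h₂⟩ := near t₂ ht₂.2 u₂ hu₂
    exact (h₁.trans ((Matching.joinedIn hr hw₁ hw₂).mono hGV)).trans h₂.symm

/-- Pointwise matching unitaries, prescribed at both ends of the interval, can be replaced by a
continuous path of almost matching unitaries with the same end points. -/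
lemma exists_continuous_of_matching {a b : I → Matrix ι ι ℂ} (ha : Continuous a) (hb : Continuous b)
    {r R ε : ℝ} (hr : 0 ≤ r) (hε : 0 < ε) (U : I → unitary (Matrix ι ι ℂ))
    (hU : ∀ t, Matching r R (a t) (b t) (U t)) :
    ∃ f : C(I, unitary (Matrix ι ι ℂ)), f 0 = U 0 ∧ f 1 = U 1 ∧
      ∀ t, ‖(f t : Matrix ι ι ℂ) * a t * star (f t : Matrix ι ι ℂ) - b t‖ < r + ε := by
  choose N hNo hsN V hV hJ using exists_nhds_joinedIn_matching (R := R) ha hb hr hε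
  obtain ⟨t, ht0, htm, ⟨n, hn⟩, hcov⟩ := exists_monotone_Icc_subset_open_cover_unitInterval hNo
    (fun s _ => Set.mem_iUnion.2 ⟨s, hsN s⟩)
  have hgood0 : ∀ s, ‖(U s : Matrix ι ι ℂ) * a s * star (U s : Matrix ι ι ℂ) - b s‖ < r + ε := by
    intro s
    have := (Matching.joinedIn hr (hU s) (hU s)).source_mem
    simp only [Set.mem_ofPred_eq] at this
    linarith
  have claim : ∀ n : ℕ, ∃ f : C(I, unitary (Matrix ι ι ℂ)), f 0 = U 0 ∧ f (t n) = U (t n) ∧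
      ∀ s ≤ t n, ‖(f s : Matrix ι ι ℂ) * a s * star (f s : Matrix ι ι ℂ) - b s‖ < r + ε := by
    intro n
    induction n with
    | zero =>
      refine ⟨ContinuousMap.const _ (U 0), rfl, by rw [ht0]; rfl, fun s hs => ?_⟩
      rw [ht0] at hs
      obtain rfl : s = 0 := le_antisymm hs bot_le
      exact hgood0 0
    | succ n ih =>
      obtain ⟨f, hf0, hf1, hf⟩ := ih
      rcases (htm (Nat.le_succ n)).eq_or_lt with heq | hlt
      · rw [Nat.succ_eq_add_one] at heq
        exact ⟨f, hf0, by rw [← heq]; exact hf1, by rw [← heq]; exact hf⟩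
      obtain ⟨i, hi⟩ := hcov n
      have m1 : t n ∈ N i := hi ⟨le_rfl, hlt.le⟩
      have m2 : t (n + 1) ∈ N i := hi ⟨hlt.le, le_rfl⟩
      obtain ⟨γ, hγ⟩ := hJ i _ m1 _ m2 _ _ (hU _) (hU _)
      have hlt' : (t n : ℝ) < t (n + 1) := hlt
      -- traverse `γ` over the interval from `t n` to `t (n + 1)`
      let g : I → unitary (Matrix ι ι ℂ) := fun s =>
        γ.extend (((s : ℝ) - t n) / ((t (n + 1) : ℝ) - t n))
      have hg : Continuous g := γ.continuous_extend.comp (by fun_prop)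
      have hg1 : g (t n) = U (t n) := by simp [g]
      have hg2 : g (t (n + 1)) = U (t (n + 1)) := by
        simp only [g]
        rw [div_self (by linarith)]; simp
      have hgV : ∀ s, g s ∈ V i := by
        intro s
        simp only [g, Path.extend]
        exact hγ _
      refine ⟨⟨fun s => if s ≤ t n then f s else g s, ?_⟩, ?_, ?_, ?_⟩
      · refine Continuous.if_le f.continuous hg continuous_id continuous_const ?_
        intro s hs
        rw [show s = t n from hs, hf1, hg1]
      · have : (0 : I) ≤ t n := bot_le
        simp [this, hf0]
      · have : ¬ t (n + 1) ≤ t n := not_le.2 hlt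
        simp [this, hg2]
      · intro s hs
        by_cases h : s ≤ t n
        · simpa [h] using hf s h
        · simpa [h] using hV i s (hi ⟨(not_le.1 h).le, hs⟩) (g s) (hgV s)
  obtain ⟨f, hf0, hf1, hf⟩ := claim n
  rw [hn n le_rfl] at hf1 hf
  exact ⟨f, hf0, hf1, fun s => hf s le_top⟩

end Paths

/-! ### Counting eigenvalues -/

section Counting

variable {ι : Type*} [Fintype ι] [DecidableEq ι]

lemma exists_conj_dg {a : Matrix ι ι ℂ} (ha : IsSelfAdjoint a) :
    ∃ (x : unitary (Matrix ι ι ℂ)) (D : ι → ℝ),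
      a = (x : Matrix ι ι ℂ) * dg D * star (x : Matrix ι ι ℂ) := by
  have h : a.IsHermitian := ha
  refine ⟨h.eigenvectorUnitary, h.eigenvalues, ?_⟩
  conv_lhs => rw [h.spectral_theorem]
  rfl

lemma mulVec_conj_dg (x : unitary (Matrix ι ι ℂ)) (D : ι → ℝ) (ξ : ι → ℂ) :
    ((x : Matrix ι ι ℂ) * dg D * star (x : Matrix ι ι ℂ)) *ᵥ ((x : Matrix ι ι ℂ) *ᵥ ξ)
      = (x : Matrix ι ι ℂ) *ᵥ fun i => (D i : ℂ) * ξ i := by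
  rw [Matrix.mulVec_mulVec, mul_assoc, Unitary.coe_star_mul_self, mul_one, ← Matrix.mulVec_mulVec]
  congr 1
  ext i
  simp [dg, Matrix.mulVec_diagonal]

/-- Diagonalisation as a homomorphism: `v ↦ x (diag v) x⋆`. -/
def conjDiagonal (x : unitary (Matrix ι ι ℂ)) : (ι → ℂ) →⋆ₙₐ[ℂ] Matrix ι ι ℂ where
  toFun v := (x : Matrix ι ι ℂ) * Matrix.diagonal v * star (x : Matrix ι ι ℂ)
  map_smul' z v := by
    rw [Matrix.diagonal_smul, mul_smul_comm, smul_mul_assoc]; rfl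
  map_zero' := by simp
  map_add' v w := by
    rw [show Matrix.diagonal (v + w) = Matrix.diagonal v + Matrix.diagonal w by
      rw [Matrix.diagonal_add]; rfl, mul_add, add_mul]
  map_mul' v w := by
    rw [show Matrix.diagonal (v * w) = Matrix.diagonal v * Matrix.diagonal w by
      rw [Matrix.diagonal_mul_diagonal]; rfl]
    simp only [mul_assoc]
    rw [← mul_assoc (star (x : Matrix ι ι ℂ)) (x : Matrix ι ι ℂ), Unitary.coe_star_mul_self,
        one_mul]
  map_star' v := by
    rw [star_mul, star_mul, star_star, Matrix.star_eq_conjTranspose (Matrix.diagonal v),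
      Matrix.diagonal_conjTranspose, mul_assoc]

lemma cutDown_conj_dg (x : unitary (Matrix ι ι ℂ)) (D : ι → ℝ) {s : ℝ} (hs : 0 ≤ s) :
    cutDown s ((x : Matrix ι ι ℂ) * dg D * star (x : Matrix ι ι ℂ))
      = (x : Matrix ι ι ℂ) * dg (fun i => max 0 (D i - s)) * star (x : Matrix ι ι ℂ) := by
  have h0 := cutDown_fun_zero hs
  have hsa : IsSelfAdjoint (fun i => (D i : ℂ)) := by
    ext i; simp
  have h := NonUnitalStarAlgHom.map_cfcₙ (R := ℝ) (conjDiagonal x) (fun t => max 0 (t - s))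
    (fun i => (D i : ℂ)) (by fun_prop) h0 ?_ hsa (hsa.map _)
  · have e : cfcₙ (fun t : ℝ => max 0 (t - s)) (fun i => (D i : ℂ)) =
        fun i => ((max 0 (D i - s) : ℝ) : ℂ) := by
      rw [cfcₙ_map_pi (S := ℂ) (fun t : ℝ => max 0 (t - s)) _ (by fun_prop) hsa
        (fun i => by simp [isSelfAdjoint_iff])]
      funext i
      rw [cfcₙ_eq_cfc (by fun_prop) h0]
      exact cfc_algebraMap (D i) (fun t : ℝ => max 0 (t - s))
    rw [e] at h
    exact h.symm
  · have : Continuous fun v : ι → ℂ => (x : Matrix ι ι ℂ) * Matrix.diagonal v *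
      star (x : Matrix ι ι ℂ) := by
      fun_prop
    exact this

/-- Quantitative rank comparison: if `x diag(D) x⋆` is within `ε` of `v (y diag(E) y⋆) v⋆`, then
`D` has at most as many entries `≥ ε` as `E` has nonzero entries. Otherwise some nonzero vector in
the span of the former eigenvectors is killed by `v (y diag(E) y⋆) v⋆`. -/
lemma card_le_card_of_norm_sub_lt {x y : unitary (Matrix ι ι ℂ)} {D E : ι → ℝ} {ε : ℝ}
    (hε : 0 < ε) (v : Matrix ι ι ℂ)
    (h : ‖(x : Matrix ι ι ℂ) * dg D * star (x : Matrix ι ι ℂ)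
      - v * ((y : Matrix ι ι ℂ) * dg E * star (y : Matrix ι ι ℂ)) * star v‖ < ε) :
    Fintype.card {i // ε ≤ D i} ≤ Fintype.card {i // E i ≠ 0} := by
  by_contra! hlt
  let T : Matrix ι ι ℂ := star (y : Matrix ι ι ℂ) * star v * x
  let ext0 : ({i // ε ≤ D i} → ℂ) →ₗ[ℂ] (ι → ℂ) :=
    { toFun := fun ξ i => if h : ε ≤ D i then ξ ⟨i, h⟩ else 0
      map_add' := fun ξ ζ => by ext i; by_cases h : ε ≤ D i <;> simp [h]
      map_smul' := fun z ξ => by ext i; by_cases h : ε ≤ D i <;> simp [h] }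
  let L : ({i // ε ≤ D i} → ℂ) →ₗ[ℂ] ({i // E i ≠ 0} → ℂ) :=
    (LinearMap.funLeft ℂ ℂ Subtype.val).comp (T.mulVecLin.comp ext0)
  have hker : LinearMap.ker L ≠ ⊥ := L.ker_ne_bot_of_finrank_lt (by
    simpa only [Module.finrank_fintype_fun_eq_card] using hlt)
  obtain ⟨ξ, hξ, hξ0⟩ := (Submodule.ne_bot_iff _).1 hker
  set ζ : ι → ℂ := ext0 ξ with hζ
  have hζoff : ∀ i, ¬ ε ≤ D i → ζ i = 0 := fun i hi => by simp [hζ, ext0, hi]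
  have hζ0 : ζ ≠ 0 := by
    intro h0
    refine hξ0 (funext fun i => ?_)
    have := congrFun h0 i
    simpa [hζ, ext0, i.2] using this
  have hTζ : ∀ i, E i ≠ 0 → (T *ᵥ ζ) i = 0 := fun i hi =>
    congrFun (LinearMap.mem_ker.1 hξ) ⟨i, hi⟩
  set M := (x : Matrix ι ι ℂ) * dg D * star (x : Matrix ι ι ℂ)
      - v * ((y : Matrix ι ι ℂ) * dg E * star (y : Matrix ι ι ℂ)) * star v with hM
  have hkill : (v * ((y : Matrix ι ι ℂ) * dg E * star (y : Matrix ι ι ℂ)) * star v) *ᵥ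
      ((x : Matrix ι ι ℂ) *ᵥ ζ) = 0 := by
    have e : (v * ((y : Matrix ι ι ℂ) * dg E * star (y : Matrix ι ι ℂ)) * star v) *
        (x : Matrix ι ι ℂ)
        = (v * (y : Matrix ι ι ℂ)) * (dg E * T) := by simp only [T, mul_assoc]
    rw [Matrix.mulVec_mulVec, e, ← Matrix.mulVec_mulVec, ← Matrix.mulVec_mulVec _ (dg E) T]
    have : dg E *ᵥ (T *ᵥ ζ) = 0 := by
      ext i
      by_cases hi : E i = 0
      · simp [dg, Matrix.mulVec_diagonal, hi]
      · simp [dg, Matrix.mulVec_diagonal, hTζ i hi]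
    rw [this, Matrix.mulVec_zero]
  have hMζ : (star (x : Matrix ι ι ℂ) * M * (x : Matrix ι ι ℂ)) *ᵥ ζ =
      fun i => (D i : ℂ) * ζ i := by
    rw [← Matrix.mulVec_mulVec, ← Matrix.mulVec_mulVec, hM, Matrix.sub_mulVec, hkill, sub_zero,
      mulVec_conj_dg, Matrix.mulVec_mulVec, Unitary.coe_star_mul_self, Matrix.one_mulVec]
  have hnorm : ‖star (x : Matrix ι ι ℂ) * M * (x : Matrix ι ι ℂ)‖ < ε := by
    have := norm_unitary_conj (star x) M
    simp only [Unitary.coe_star, star_star] at this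
    rwa [this]
  have h1 := Matrix.l2_opNorm_mulVec (star (x : Matrix ι ι ℂ) * M * (x : Matrix ι ι ℂ))
    (WithLp.toLp 2 ζ)
  simp only [hMζ] at h1
  have hpos : 0 < ‖(WithLp.toLp 2 ζ : EuclideanSpace ℂ ι)‖ := by
    rw [norm_pos_iff]
    intro h0
    exact hζ0 (by simpa using congrArg WithLp.ofLp h0)
  have h2 : ε * ‖(WithLp.toLp 2 ζ : EuclideanSpace ℂ ι)‖ ≤
      ‖(WithLp.toLp 2 (fun i => (D i : ℂ) * ζ i) : EuclideanSpace ℂ ι)‖ := by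
    rw [← abs_of_pos hε, ← Real.norm_eq_abs, ← sq_le_sq₀ (by positivity) (by positivity), mul_pow,
      EuclideanSpace.norm_sq_eq, EuclideanSpace.norm_sq_eq, Finset.mul_sum]
    refine Finset.sum_le_sum fun i _ => ?_
    by_cases hi : ε ≤ D i
    · simp only [norm_mul, mul_pow, Complex.norm_real, Real.norm_eq_abs, abs_of_pos hε,
        abs_of_pos (hε.trans_le hi)]
      gcongr
    · simp [hζoff i hi]
  have h3 : ‖star (x : Matrix ι ι ℂ) * M * (x : Matrix ι ι ℂ)‖ *
      ‖(WithLp.toLp 2 ζ : EuclideanSpace ℂ ι)‖ <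
      ε * ‖(WithLp.toLp 2 ζ : EuclideanSpace ℂ ι)‖ := by gcongr
  exact absurd (h2.trans h1) (not_le.2 h3)

end Counting

section Counting

variable {ι : Type*} [Fintype ι] [DecidableEq ι]

open scoped ComplexOrder in
lemma mem_Icc_of_conj_dg {a c : Matrix ι ι ℂ} {x : unitary (Matrix ι ι ℂ)} {D : ι → ℝ} {R : ℝ}
    (hac : a = star c * c) (haR : ‖a‖ ≤ R)
    (h : a = (x : Matrix ι ι ℂ) * dg D * star (x : Matrix ι ι ℂ)) (i : ι) : D i ∈ Set.Icc 0 R := by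
  constructor
  · have e : dg D = (c * (x : Matrix ι ι ℂ))ᴴ * (c * (x : Matrix ι ι ℂ)) := by
      have e1 : star (x : Matrix ι ι ℂ) * a * (x : Matrix ι ι ℂ) = dg D := by
        rw [h]
        simp only [mul_assoc, Unitary.coe_star_mul_self, mul_one]
        rw [← mul_assoc, Unitary.coe_star_mul_self, one_mul]
      rw [← e1, hac, ← Matrix.star_eq_conjTranspose, star_mul]
      simp only [mul_assoc]
    have h2 := (Matrix.posSemidef_conjTranspose_mul_self
      (c * (x : Matrix ι ι ℂ))).diag_nonneg (i := i)
    rw [← e, dg, Matrix.diagonal_apply_eq] at h2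
    exact_mod_cast h2
  · have h1 : ‖dg D‖ ≤ R := by rwa [h, norm_unitary_conj] at haR
    rw [dg, Matrix.l2_opNorm_diagonal] at h1
    have h2 := (norm_le_pi_norm (fun i => (D i : ℂ)) i).trans h1
    rw [Complex.norm_real] at h2
    exact (le_abs_self _).trans h2

omit [DecidableEq ι] in
/-- It suffices to compare the counting functions on the grid `ε, 2ε, …, Nε`: rounding `s` up to the
grid costs one `ε`. -/
lemma card_le_of_grid {D E : ι → ℝ} {r ε : ℝ} {N : ℕ} (hε : 0 < ε) (hr : 0 ≤ r)
    (hD : ∀ i, D i ≤ N * ε)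
    (h : ∀ p : ℕ, 1 ≤ p → p ≤ N → Fintype.card {i // ε ≤ max 0 (D i - (p * ε + r))}
      ≤ Fintype.card {i // max 0 (E i - p * ε) ≠ 0}) {s : ℝ} (hs : 0 < s) :
    Fintype.card {i // s + (r + 2 * ε) < D i} ≤ Fintype.card {i // s < E i} := by
  set p := ⌈s / ε⌉₊ with hp
  have hp1 : 1 ≤ p := Nat.one_le_iff_ne_zero.2 (Nat.ceil_pos.2 (by positivity)).ne'
  have hps : s ≤ p * ε := by
    have := Nat.le_ceil (s / ε)
    rwa [div_le_iff₀ hε] at this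
  have hps' : p * ε < s + ε := by
    have := Nat.ceil_lt_add_one (show 0 ≤ s / ε by positivity)
    rw [← hp, ← sub_lt_iff_lt_add, lt_div_iff₀ hε] at this
    linarith
  rcases le_or_gt p N with hpN | hpN
  · refine le_trans (Fintype.card_subtype_mono _ _ fun i hi => ?_)
      ((h p hp1 hpN).trans (Fintype.card_subtype_mono _ _ fun i hi => ?_))
    · exact le_max_of_le_right (by linarith)
    · by_contra! hle
      exact hi (max_eq_left (by linarith))
  · have : IsEmpty {i // s + (r + 2 * ε) < D i} := by
      refine ⟨fun ⟨i, hi⟩ => ?_⟩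
      have h1 : ((N : ℝ) + 1) * ε ≤ p * ε := by
        gcongr
        exact_mod_cast hpN
      have := hD i
      linarith
    rw [Fintype.card_eq_zero]
    exact Nat.zero_le _

lemma hom_cutDown {B C : Type*} [NonUnitalCStarAlgebra B] [NonUnitalCStarAlgebra C]
    (π : B →⋆ₙₐ[ℂ] C) {a : B} (ha : IsSelfAdjoint a)
    {s : ℝ} (hs : 0 ≤ s) : π (cutDown s a) = cutDown s (π a) :=
  NonUnitalStarAlgHom.map_cfcₙ (R := ℝ) π _ a (by fun_prop) (cutDown_fun_zero hs)
    (AddMonoidHomClass.continuous_of_bound π 1 fun x => by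
      simpa using NonUnitalStarAlgHom.norm_apply_le π x) ha (ha.map π)

/-- Approximate Cuntz comparison of finitely many cut-downs yields a matching unitary in every
finite-dimensional representation. -/
lemma exists_matching_of_hom {B : Type*} [NonUnitalCStarAlgebra B] (π : B →⋆ₙₐ[ℂ] Matrix ι ι ℂ)
    {a b c d : B} (hac : a = star c * c) (hbd : b = star d * d) {r ε : ℝ} {N : ℕ} (hε : 0 < ε)
    (hr : 0 ≤ r) (haN : ‖a‖ ≤ N * ε) (hbN : ‖b‖ ≤ N * ε)
    (h1 : ∀ p : ℕ, 1 ≤ p → p ≤ N →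
      ∃ v : B, ‖cutDown (p * ε + r) a - v * cutDown (p * ε) b * star v‖ < ε)
    (h2 : ∀ p : ℕ, 1 ≤ p → p ≤ N →
      ∃ v : B, ‖cutDown (p * ε + r) b - v * cutDown (p * ε) a * star v‖ < ε) :
    ∃ u, Matching (r + 2 * ε) (N * ε) (π a) (π b) u := by
  have haa : IsSelfAdjoint a := hac ▸ IsSelfAdjoint.star_mul_self c
  have hba : IsSelfAdjoint b := hbd ▸ IsSelfAdjoint.star_mul_self d
  obtain ⟨x, D, hx⟩ := exists_conj_dg (haa.map π)
  obtain ⟨y, E, hy⟩ := exists_conj_dg (hba.map π)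
  have hD := mem_Icc_of_conj_dg (c := π c) (by rw [hac, map_mul, map_star])
    ((NonUnitalStarAlgHom.norm_apply_le π a).trans haN) hx
  have hE := mem_Icc_of_conj_dg (c := π d) (by rw [hbd, map_mul, map_star])
    ((NonUnitalStarAlgHom.norm_apply_le π b).trans hbN) hy
  have key : ∀ (a b : B) (x y : unitary (Matrix ι ι ℂ)) (D E : ι → ℝ), IsSelfAdjoint a →
      IsSelfAdjoint b → π a = (x : Matrix ι ι ℂ) * dg D * star (x : Matrix ι ι ℂ) →
      π b = (y : Matrix ι ι ℂ) * dg E * star (y : Matrix ι ι ℂ) →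
      (∀ p : ℕ, 1 ≤ p → p ≤ N →
        ∃ v : B, ‖cutDown (p * ε + r) a - v * cutDown (p * ε) b * star v‖ < ε) →
      ∀ p : ℕ, 1 ≤ p → p ≤ N → Fintype.card {i // ε ≤ max 0 (D i - (p * ε + r))}
        ≤ Fintype.card {i // max 0 (E i - p * ε) ≠ 0} := by
    intro a b x y D E ha hb hx hy h p hp1 hpN
    obtain ⟨v, hv⟩ := h p hp1 hpN
    have hv' := (NonUnitalStarAlgHom.norm_apply_le π _).trans_lt hv
    rw [map_sub, map_mul, map_mul, map_star, hom_cutDown π ha (by positivity),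
      hom_cutDown π hb (by positivity), hx, hy, cutDown_conj_dg _ _ (by positivity),
      cutDown_conj_dg _ _ (by positivity)] at hv'
    exact card_le_card_of_norm_sub_lt hε _ hv'
  obtain ⟨τ, hτ, hτ'⟩ := exists_perm_monovary_of_card_le (r := r + 2 * ε)
    (fun i => (hD i).1) (fun i => (hE i).1)
    (fun s hs => card_le_of_grid hε hr (fun i => (hD i).2) (key a b x y D E haa hba hx hy h1) hs)
    (fun s hs => card_le_of_grid hε hr (fun i => (hE i).2) (key b a y x E D hba haa hy hx h2) hs)
  exact ⟨permCols y τ * star x, x, permCols y τ, D, E ∘ τ, hτ, hD, fun i => hE _, hτ', hx,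
    by rw [hy, permCols_conj_dg], rfl⟩

end Counting

/-! ### Matching unitaries in Razak blocks -/

section Ends

variable {κ ν : Type*} [Fintype κ] [DecidableEq κ] [Fintype ν] [DecidableEq ν]

/-- For a projection `q` in `M_ν`, the unitary `x ⊗ q + 1 ⊗ (1 - q)`. -/
def ampUnitary (q : Matrix ν ν ℂ) (hq : q * q = q) (hq' : qᴴ = q) (x : unitary (Matrix κ κ ℂ)) :
    unitary (Matrix (κ × ν) (κ × ν) ℂ) :=
  ⟨(x : Matrix κ κ ℂ) ⊗ₖ q + 1 ⊗ₖ (1 - q), by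
    rw [Unitary.mem_iff, Matrix.star_eq_conjTranspose, Matrix.conjTranspose_add,
      Matrix.conjTranspose_kronecker, Matrix.conjTranspose_kronecker, Matrix.conjTranspose_sub, hq',
      ← Matrix.star_eq_conjTranspose (x : Matrix κ κ ℂ)]
    simp only [Matrix.conjTranspose_one, mul_add, add_mul, ← Matrix.mul_kronecker_mul, mul_sub,
      sub_mul, hq, mul_one, one_mul, sub_self, Matrix.kronecker_zero, add_zero, zero_add, sub_zero,
      Unitary.coe_star_mul_self, Unitary.mul_star_self_of_mem x.2, ← Matrix.kronecker_add]
    simp⟩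

lemma ampUnitary_mul_star (q : Matrix ν ν ℂ) (hq : q * q = q) (hq' : qᴴ = q)
    (x y : unitary (Matrix κ κ ℂ)) :
    ampUnitary q hq hq' (y * star x) = ampUnitary q hq hq' y * star (ampUnitary q hq hq' x) := by
  apply Subtype.ext
  simp only [ampUnitary, Submonoid.coe_mul, Unitary.coe_star]
  rw [Matrix.star_eq_conjTranspose (_ + _), Matrix.conjTranspose_add,
    Matrix.conjTranspose_kronecker, Matrix.conjTranspose_kronecker, Matrix.conjTranspose_sub, hq',
    ← Matrix.star_eq_conjTranspose (x : Matrix κ κ ℂ)]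
  simp only [Matrix.conjTranspose_one, mul_add, add_mul, ← Matrix.mul_kronecker_mul, mul_sub,
      sub_mul, hq, mul_one, one_mul, sub_self, Matrix.kronecker_zero, add_zero, zero_add, sub_zero]

lemma ampUnitary_conj (q : Matrix ν ν ℂ) (hq : q * q = q) (hq' : qᴴ = q)
    (x : unitary (Matrix κ κ ℂ)) (d : Matrix κ κ ℂ) :
    (ampUnitary q hq hq' x : Matrix (κ × ν) (κ × ν) ℂ) * (d ⊗ₖ q) *
        star (ampUnitary q hq hq' x : Matrix (κ × ν) (κ × ν) ℂ)
      = ((x : Matrix κ κ ℂ) * d * star (x : Matrix κ κ ℂ)) ⊗ₖ q := by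
  simp only [ampUnitary]
  rw [Matrix.star_eq_conjTranspose (_ + _), Matrix.conjTranspose_add,
    Matrix.conjTranspose_kronecker, Matrix.conjTranspose_kronecker, Matrix.conjTranspose_sub, hq',
    ← Matrix.star_eq_conjTranspose (x : Matrix κ κ ℂ)]
  simp only [Matrix.conjTranspose_one, mul_add, add_mul, ← Matrix.mul_kronecker_mul, mul_sub,
      sub_mul, hq, mul_one, one_mul, sub_self, Matrix.kronecker_zero, add_zero]

/-- A matching unitary for `(a, b)` amplifies to one for `(a ⊗ q, b ⊗ q)`, acting trivially off
`q`. Comonotonicity survives because the eigenvalues are nonnegative, so that the new eigenvalue `0`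
is the smallest. -/
lemma Matching.ampUnitary {r R : ℝ} (hr : 0 ≤ r) {a b : Matrix κ κ ℂ} {w : unitary (Matrix κ κ ℂ)}
    (h : Matching r R a b w) (q : Matrix ν ν ℂ) (hq : q * q = q) (hq' : qᴴ = q) {χ : ν → ℝ}
    (hχ : ∀ j, χ j = 0 ∨ χ j = 1) (hqχ : q = dg χ) :
    Matching r R (a ⊗ₖ q) (b ⊗ₖ q) (ampUnitary q hq hq' w) := by
  obtain ⟨x, y, D, E, h1, h2, h3, h4, h5, h6, h7⟩ := h
  have hkron : ∀ D : κ → ℝ, dg D ⊗ₖ q = dg (fun ij : κ × ν => D ij.1 * χ ij.2) := by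
    intro D
    rw [hqχ, dg, dg, Matrix.diagonal_kronecker_diagonal, dg]
    simp
  refine ⟨_root_.ampUnitary q hq hq' x, _root_.ampUnitary q hq hq' y, fun ij => D ij.1 * χ ij.2,
    fun ij => E ij.1 * χ ij.2, ?_, ?_, ?_, ?_, ?_, ?_, ?_⟩
  · rintro ⟨i, j⟩ ⟨i', j'⟩ hlt
    simp only at hlt ⊢
    rcases hχ j with hj | hj <;> rcases hχ j' with hj' | hj' <;>
      simp only [hj, hj', mul_zero, mul_one, le_refl] at hlt ⊢
    · exact (h2 i').1
    · exact absurd hlt (not_lt.2 (h3 i).1)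
    · exact h1 hlt
  · rintro ⟨i, j⟩
    rcases hχ j with hj | hj
    · simpa [hj] using (h2 i).1.trans (h2 i).2
    · simpa [hj] using h2 i
  · rintro ⟨i, j⟩
    rcases hχ j with hj | hj
    · simpa [hj] using (h2 i).1.trans (h2 i).2
    · simpa [hj] using h3 i
  · rintro ⟨i, j⟩
    rcases hχ j with hj | hj
    · simpa [hj] using hr
    · simpa [hj] using h4 i
  · rw [← hkron, ampUnitary_conj, h5]
  · rw [← hkron, ampUnitary_conj, h6]
  · rw [h7, ampUnitary_mul_star]

end Ends

section Block

variable {k n : ℕ}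

/-- Evaluation of elements of a Razak block at a point of the interval. -/
def evalHom (k n : ℕ) (t : I) :
    razakBlock k n →⋆ₙₐ[ℂ] Matrix (Fin k × Fin n) (Fin k × Fin n) ℂ where
  toFun f := (f : C(I, Matrix (Fin k × Fin n) (Fin k × Fin n) ℂ)) t
  map_smul' _ _ := rfl
  map_zero' := rfl
  map_add' _ _ := rfl
  map_mul' _ _ := rfl
  map_star' _ := rfl

lemma exists_coeff (hn : 0 < n) (f : razakBlock k n) :
    f.1 0 = ((f.1 1).submatrix (fun i => (i, ⟨0, hn⟩)) fun i => (i, ⟨0, hn⟩)) ⊗ₖ cornerOne n ∧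
    f.1 1 = ((f.1 1).submatrix (fun i => (i, ⟨0, hn⟩)) fun i => (i, ⟨0, hn⟩)) ⊗ₖ 1 := by
  obtain ⟨c, h0, h1⟩ := f.2
  have : (f.1 1).submatrix (fun i => (i, (⟨0, hn⟩ : Fin n))) (fun i => (i, ⟨0, hn⟩)) = c := by
    ext i j
    rw [h1]
    simp [Matrix.kroneckerMap_apply]
  rw [this]
  exact ⟨h0, h1⟩

/-- The representation of a Razak block on `M_k` that sends `f` to the matrix `c` with
`f 0 = c ⊗ 1_{n-1}` and `f 1 = c ⊗ 1_n`. -/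
def coeffHom (hn : 0 < n) : razakBlock k n →⋆ₙₐ[ℂ] Matrix (Fin k) (Fin k) ℂ where
  toFun f := (f.1 1).submatrix (fun i => (i, ⟨0, hn⟩)) fun i => (i, ⟨0, hn⟩)
  map_smul' _ _ := rfl
  map_zero' := rfl
  map_add' _ _ := rfl
  map_mul' f g := by
    have hf := (exists_coeff hn f).2
    have hg := (exists_coeff hn g).2
    set c := (f.1 1).submatrix (fun i => (i, (⟨0, hn⟩ : Fin n))) fun i => (i, ⟨0, hn⟩)
    set d := (g.1 1).submatrix (fun i => (i, (⟨0, hn⟩ : Fin n))) fun i => (i, ⟨0, hn⟩)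
    change (f.1 1 * g.1 1).submatrix _ _ = c * d
    rw [hf, hg, ← Matrix.mul_kronecker_mul]
    ext i j
    simp [Matrix.kroneckerMap_apply]
  map_star' _ := rfl

/-- In a Razak block, pointwise matching unitaries together with a matching unitary for the
coefficients at the end points give a unitary `1 + z` of the unitisation that almost matches. -/
lemma exists_unitary_razakBlock (hn : 0 < n) (a b : razakBlock k n) {r R ε : ℝ} (hr : 0 ≤ r)
    (hε : 0 < ε) (h : ∀ t, ∃ u, Matching r R (evalHom k n t a) (evalHom k n t b) u)
    (hc : ∃ w, Matching r R (coeffHom hn a) (coeffHom hn b) w) :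
    ∃ z : razakBlock k n, z + star z + z * star z = 0 ∧ z + star z + star z * z = 0 ∧
      ‖a + z * a + a * star z + z * a * star z - b‖ ≤ r + ε := by
  obtain ⟨w, hw⟩ := hc
  choose u hu using h
  have hq1 := cornerOne_mul_self n
  have hq2 := cornerOne_conjTranspose n
  let u0 := ampUnitary (cornerOne n) hq1 hq2 w
  let u1 := ampUnitary (1 : Matrix (Fin n) (Fin n) ℂ) (one_mul 1) Matrix.conjTranspose_one w
  let U : I → unitary (Matrix (Fin k × Fin n) (Fin k × Fin n) ℂ) := fun t =>
    if t = 0 then u0 else if t = 1 then u1 else u t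
  have h01 : (1 : I) ≠ 0 := one_ne_zero
  have hU : ∀ t, Matching r R (a.1 t) (b.1 t) (U t) := by
    intro t
    by_cases h0 : t = 0
    · simp only [U, h0, if_true]
      rw [(exists_coeff hn a).1, (exists_coeff hn b).1]
      refine hw.ampUnitary hr (cornerOne n) hq1 hq2
        (χ := fun j => if (j : ℕ) + 1 < n then 1 else 0) (fun j => by split_ifs <;> simp) ?_
      simp only [cornerOne, dg]
      congr 1
      ext j
      split_ifs <;> simp
    by_cases h1 : t = 1
    · simp only [U, h1, h01, if_true, if_false]
      rw [(exists_coeff hn a).2, (exists_coeff hn b).2]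
      refine hw.ampUnitary hr 1 _ _ (χ := fun j => 1) (fun j => Or.inr rfl) ?_
      simp [dg]
    · simp only [U, h0, h1, if_false]
      exact hu t
  obtain ⟨f, hf0, hf1, hf⟩ := exists_continuous_of_matching a.1.continuous b.1.continuous hr hε U hU
  have hf0' : (f 0 : Matrix (Fin k × Fin n) (Fin k × Fin n) ℂ)
      = (w : Matrix (Fin k) (Fin k) ℂ) ⊗ₖ cornerOne n + 1 ⊗ₖ (1 - cornerOne n) := by
    rw [hf0]; simp only [U, if_true]; rfl
  have hf1' : (f 1 : Matrix (Fin k × Fin n) (Fin k × Fin n) ℂ)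
      = (w : Matrix (Fin k) (Fin k) ℂ) ⊗ₖ 1 + 1 ⊗ₖ (1 - 1) := by
    rw [hf1]; simp only [U, h01, if_true, if_false]; rfl
  let zf : C(I, Matrix (Fin k × Fin n) (Fin k × Fin n) ℂ) :=
    ⟨fun t => (f t : Matrix (Fin k × Fin n) (Fin k × Fin n) ℂ) - 1, by fun_prop⟩
  have hone : (1 : Matrix (Fin k × Fin n) (Fin k × Fin n) ℂ) =
      (1 : Matrix (Fin k) (Fin k) ℂ) ⊗ₖ 1 := by
    simp
  let z : razakBlock k n := ⟨zf, (w : Matrix (Fin k) (Fin k) ℂ) - 1, by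
    change (f 0 : Matrix (Fin k × Fin n) (Fin k × Fin n) ℂ) - 1 = _
    rw [hf0', hone]
    ext ⟨i, j⟩ ⟨i', j'⟩
    simp only [Matrix.kroneckerMap_apply, Matrix.sub_apply, Matrix.add_apply]
    ring, by
    change (f 1 : Matrix (Fin k × Fin n) (Fin k × Fin n) ℂ) - 1 = _
    rw [hf1', hone]
    ext ⟨i, j⟩ ⟨i', j'⟩
    simp only [Matrix.kroneckerMap_apply, Matrix.sub_apply, Matrix.add_apply]
    ring⟩
  refine ⟨z, ?_, ?_, ?_⟩
  · apply Subtype.ext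
    ext1 t
    change ((f t : Matrix (Fin k × Fin n) (Fin k × Fin n) ℂ) - 1) +
        star ((f t : Matrix (Fin k × Fin n) (Fin k × Fin n) ℂ) - 1) +
      ((f t : Matrix (Fin k × Fin n) (Fin k × Fin n) ℂ) - 1) *
          star ((f t : Matrix (Fin k × Fin n) (Fin k × Fin n) ℂ) - 1) = 0
    have := Unitary.mul_star_self_of_mem (f t).2
    rw [star_sub, star_one, sub_mul, mul_sub, this]
    simp
  · apply Subtype.ext
    ext1 t
    change ((f t : Matrix (Fin k × Fin n) (Fin k × Fin n) ℂ) - 1) +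
        star ((f t : Matrix (Fin k × Fin n) (Fin k × Fin n) ℂ) - 1) +
      star ((f t : Matrix (Fin k × Fin n) (Fin k × Fin n) ℂ) - 1) *
          ((f t : Matrix (Fin k × Fin n) (Fin k × Fin n) ℂ) - 1) = 0
    have := Unitary.star_mul_self_of_mem (f t).2
    rw [star_sub, star_one, sub_mul, mul_sub, this]
    simp only [mul_one, one_mul]
    abel
  · change ‖a.1 + zf * a.1 + a.1 * star zf + zf * a.1 * star zf - b.1‖ ≤ _
    rw [ContinuousMap.norm_le _ (by positivity)]
    intro t
    refine le_trans (le_of_eq ?_) (hf t).le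
    change ‖a.1 t + ((f t : Matrix (Fin k × Fin n) (Fin k × Fin n) ℂ) - 1) * a.1 t +
        a.1 t * star ((f t : Matrix (Fin k × Fin n) (Fin k × Fin n) ℂ) - 1) +
      ((f t : Matrix (Fin k × Fin n) (Fin k × Fin n) ℂ) - 1) * a.1 t *
          star ((f t : Matrix (Fin k × Fin n) (Fin k × Fin n) ℂ) - 1) - b.1 t‖ = _
    congr 1
    rw [star_sub, star_one]
    simp only [sub_mul, mul_sub, one_mul, mul_one]
    abel

/-- The approximate block version of `dU ≤ dW`: if finitely many cut-downs of `a` and `b` compare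
approximately, then some unitary `1 + z` moves `a` close to `b`. -/
lemma exists_unitary_razakSum {l : ℕ} {k n : Fin l → ℕ} (hn : ∀ j, 0 < n j)
    {a b c d : RazakSum l k n} (hac : a = star c * c)
    (hbd : b = star d * d) {r ε : ℝ} {N : ℕ} (hε : 0 < ε)
    (hr : 0 ≤ r) (haN : ‖a‖ ≤ N * ε) (hbN : ‖b‖ ≤ N * ε)
    (h1 : ∀ p : ℕ, 1 ≤ p → p ≤ N →
      ∃ v : RazakSum l k n, ‖cutDown (p * ε + r) a - v * cutDown (p * ε) b * star v‖ < ε)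
    (h2 : ∀ p : ℕ, 1 ≤ p → p ≤ N →
      ∃ v : RazakSum l k n, ‖cutDown (p * ε + r) b - v * cutDown (p * ε) a * star v‖ < ε) :
    ∃ z : RazakSum l k n, z + star z + z * star z = 0 ∧ z + star z + star z * z = 0 ∧
      ‖a + z * a + a * star z + z * a * star z - b‖ ≤ r + 3 * ε := by
  let π : ∀ j, RazakSum l k n →⋆ₙₐ[ℂ] razakBlock (k j) (n j) := fun j =>
    Pi.evalNonUnitalStarAlgHom ℂ (fun j => razakBlock (k j) (n j)) j
  have hblock : ∀ j, ∃ z : razakBlock (k j) (n j), z + star z + z * star z = 0 ∧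
      z + star z + star z * z = 0 ∧
      ‖π j a + z * π j a + π j a * star z + z * π j a * star z - π j b‖ ≤ r + 2 * ε + ε := fun j =>
    exists_unitary_razakBlock (hn j) (π j a) (π j b) (by positivity) hε
      (fun t => exists_matching_of_hom ((evalHom _ _ t).comp (π j)) hac hbd hε hr haN hbN h1 h2)
      (exists_matching_of_hom ((coeffHom (hn j)).comp (π j)) hac hbd hε hr haN hbN h1 h2)
  choose z hz1 hz2 hz3 using hblock
  refine ⟨z, funext hz1, funext hz2, ?_⟩
  refine (pi_norm_le_iff_of_nonneg (by positivity)).2 fun j => ?_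
  refine (hz3 j).trans (by linarith)

end Block

/-! ### Pulling back to a finite stage of an inductive limit -/

section Limit

variable {B : ℕ → Type*} [∀ i, NonUnitalCStarAlgebra (B i)] {A : Type*} [NonUnitalCStarAlgebra A]
  {φ : ∀ i, B i →⋆ₙₐ[ℂ] B (i + 1)} {μ : ∀ i, B i →⋆ₙₐ[ℂ] A}

lemma IsInductiveLimit.map_connect (h : IsInductiveLimit φ μ) (i m : ℕ) (x : B i) :
    μ (i + m) (connect φ i m x) = μ i x := by
  induction m with
  | zero => rfl
  | succ m ih => exact (h.compatible (i + m) (connect φ i m x)).trans ih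

lemma IsInductiveLimit.exists_lift (h : IsInductiveLimit φ μ) {i j : ℕ} (hij : i ≤ j) (x : B i) :
    ∃ y : B j, μ j y = μ i x := by
  obtain ⟨m, rfl⟩ := Nat.exists_eq_add_of_le hij
  exact ⟨_, h.map_connect i m x⟩

lemma IsInductiveLimit.exists_mem_nhds (h : IsInductiveLimit φ μ) (a : A) {s : Set A}
    (hs : s ∈ 𝓝 a) : ∃ i, ∀ j, i ≤ j → ∃ y : B j, μ j y ∈ s := by
  obtain ⟨x, hx, hxU⟩ := mem_closure_iff_nhds.1 (h.dense a) s hs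
  obtain ⟨i, y, rfl⟩ := Set.mem_iUnion.1 hxU
  refine ⟨i, fun j hij => ?_⟩
  obtain ⟨z, hz⟩ := h.exists_lift hij y
  exact ⟨z, by rwa [hz]⟩

/-- An approximate Cuntz comparison in the limit already holds at a finite stage. -/
lemma IsInductiveLimit.exists_stage (h : IsInductiveLimit φ μ) {i : ℕ} (x y : B i) {ε : ℝ} (v : A)
    (hv : ‖μ i x - v * μ i y * star v‖ < ε) :
    ∃ (j : ℕ) (ψ : B i →⋆ₙₐ[ℂ] B j), (∀ x, μ j (ψ x) = μ i x) ∧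
      ∃ w : B j, ‖ψ x - w * ψ y * star w‖ < ε := by
  have hopen : IsOpen {v : A | ‖μ i x - v * μ i y * star v‖ < ε} :=
    isOpen_lt (by fun_prop) continuous_const
  obtain ⟨i', hi'⟩ := h.exists_mem_nhds v (hopen.mem_nhds hv)
  obtain ⟨w, hw⟩ := hi' (i + i') (Nat.le_add_left _ _)
  simp only [Set.mem_ofPred_eq] at hw
  set X := connect φ i i' x - w * connect φ i i' y * star w with hX
  have hμX : ‖μ (i + i') X‖ < ε := by
    rwa [hX, map_sub, map_mul, map_mul, map_star, h.map_connect, h.map_connect]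
  obtain ⟨m, hm⟩ := ((h.norm_eq (i + i') X).eventually (gt_mem_nhds hμX)).exists
  refine ⟨i + i' + m, (connect φ (i + i') m).comp (connect φ i i'), fun x => ?_,
    connect φ (i + i') m w, ?_⟩
  · rw [NonUnitalStarAlgHom.comp_apply, h.map_connect, h.map_connect]
  · rwa [hX, map_sub, map_mul, map_mul, map_star] at hm

lemma IsInductiveLimit.exists_stage_finset (h : IsInductiveLimit φ μ) {κ : Type*} [DecidableEq κ]
    {i : ℕ} (x y : κ → B i) {ε : ℝ} (S : Finset κ)
    (hS : ∀ p ∈ S, ∃ v : A, ‖μ i (x p) - v * μ i (y p) * star v‖ < ε) :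
    ∃ (j : ℕ) (ψ : B i →⋆ₙₐ[ℂ] B j), (∀ x, μ j (ψ x) = μ i x) ∧
      ∀ p ∈ S, ∃ w : B j, ‖ψ (x p) - w * ψ (y p) * star w‖ < ε := by
  induction S using Finset.induction_on with
  | empty => exact ⟨i, NonUnitalStarAlgHom.id ℂ _, fun _ => rfl, by simp⟩
  | insert q S _ ih =>
    obtain ⟨j, ψ, hψ, hj⟩ := ih fun p hp => hS p (Finset.mem_insert_of_mem hp)
    obtain ⟨v, hv⟩ := hS q (Finset.mem_insert_self _ _)
    rw [← hψ, ← hψ] at hv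
    obtain ⟨j', ψ', hψ', w, hw⟩ := h.exists_stage (ψ (x q)) (ψ (y q)) v hv
    refine ⟨j', ψ'.comp ψ, fun x => by rw [NonUnitalStarAlgHom.comp_apply, hψ', hψ],
      fun p hp => ?_⟩
    rcases Finset.mem_insert.1 hp with rfl | hp
    · exact ⟨w, hw⟩
    · obtain ⟨w', hw'⟩ := hj p hp
      refine ⟨ψ' w', lt_of_le_of_lt ?_ hw'⟩
      have := NonUnitalStarAlgHom.norm_apply_le ψ' (ψ (x p) - w' * ψ (y p) * star w')
      rwa [map_sub, map_mul, map_mul, map_star] at this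

end Limit

/-! ### Unitary orbits in the limit -/

section Unitization

variable {A : Type*} [NonUnitalCStarAlgebra A]

/-- An element `z` with `(1 + z)(1 + z)⋆ = 1 = (1 + z)⋆(1 + z)`, written without the unit, bounds
`dU`. -/
lemma dU_le_of_quasiunitary {a b z : A} (h1 : z + star z + z * star z = 0)
    (h2 : z + star z + star z * z = 0) :
    dU a b ≤ ‖a + z * a + a * star z + z * a * star z - b‖ := by
  have e1 : (z : Unitization ℂ A) + star (z : Unitization ℂ A) + z * star (z : Unitization ℂ A) =
      0 := by
    rw [← Unitization.inr_star, ← Unitization.inr_mul, ← Unitization.inr_add, ← Unitization.inr_add,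
      h1, Unitization.inr_zero]
  have e2 : (z : Unitization ℂ A) + star (z : Unitization ℂ A) + star (z : Unitization ℂ A) * z =
      0 := by
    rw [← Unitization.inr_star, ← Unitization.inr_mul, ← Unitization.inr_add, ← Unitization.inr_add,
      h2, Unitization.inr_zero]
  let u : unitary (Unitization ℂ A) := ⟨1 + z, by
    rw [Unitary.mem_iff, star_add, star_one]
    constructor
    · calc _ = 1 + ((z : Unitization ℂ A) + star (z : Unitization ℂ A) +
        star (z : Unitization ℂ A) * z) := by
            noncomm_ring
        _ = 1 := by rw [e2, add_zero]
    · calc _ = 1 + ((z : Unitization ℂ A) + star (z : Unitization ℂ A) +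
        z * star (z : Unitization ℂ A)) := by
            noncomm_ring
        _ = 1 := by rw [e1, add_zero]⟩
  refine (ciInf_le (bddBelow_dU_range a b) u).trans (le_of_eq ?_)
  rw [← Unitization.norm_inr (𝕜 := ℂ) (a := a + z * a + a * star z + z * a * star z - b)]
  congr 1
  simp only [u, Unitization.inr_sub, Unitization.inr_add, Unitization.inr_mul, Unitization.inr_star,
    star_add, star_one]
  noncomm_ring

end Unitization

lemma dU_le_of_dist_le {A : Type*} [NonUnitalCStarAlgebra A] {a b a' b' : A} :
    dU a b ≤ dU a' b' + ‖a - a'‖ + ‖b - b'‖ := by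
  rw [add_assoc, ← sub_le_iff_le_add]
  refine le_ciInf fun u => ?_
  rw [sub_le_iff_le_add]
  refine (ciInf_le (bddBelow_dU_range a b) u).trans ?_
  have e : (u : Unitization ℂ A) * a * star (u : Unitization ℂ A) - (b : Unitization ℂ A) =
      ((u : Unitization ℂ A) * a' * star (u : Unitization ℂ A) - (b' : Unitization ℂ A)) +
      ((u : Unitization ℂ A) * ((a - a' : A) : Unitization ℂ A) * star (u : Unitization ℂ A)
        - ((b - b' : A) : Unitization ℂ A)) := by
    simp only [Unitization.inr_sub, mul_sub, sub_mul]; abel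
  rw [e]
  refine (norm_add_le _ _).trans (add_le_add le_rfl ((norm_sub_le _ _).trans ?_))
  rw [Unitization.norm_inr, ← Unitary.coe_star, CStarRing.norm_mul_coe_unitary,
    CStarRing.norm_coe_unitary_mul, Unitization.norm_inr]

theorem mainTheorem4 {A : Type*} [NonUnitalCStarAlgebra A] [PartialOrder A] [StarOrderedRing A]
    (hA : IsLimitOfRazakSums A) (a b : A) (ha : 0 ≤ a) (hb : 0 ≤ b) :
    dU a b = dW a b := by
  refine le_antisymm (le_csInf (nonempty_dW_set ha hb) ?_) (dW_le_dU ha hb)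
  rintro r ⟨hr, hcomp⟩
  refine le_of_forall_pos_le_add fun ε' hε' => ?_
  obtain ⟨ε, hε, hεε'⟩ : ∃ ε : ℝ, 0 < ε ∧ 7 * ε = ε' := ⟨ε' / 7, by positivity, by ring⟩
  obtain ⟨l, k, n, φ, μ, hkn, hlim⟩ := hA
  -- approximate `a` and `b` by positive elements of a common finite stage
  have happrox : ∀ a : A, 0 ≤ a → ∃ i, ∀ j, i ≤ j → ∃ c : RazakSum (l j) (k j) (n j),
      ‖μ j (star c * c) - a‖ ≤ ε := by
    intro a ha
    have hsq : star (CFC.sqrt a) * CFC.sqrt a = a := by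
      rw [(CFC.sqrt_nonneg a).isSelfAdjoint.star_eq, CFC.sqrt_mul_sqrt_self a ha]
    have hopen : IsOpen {s : A | ‖star s * s - a‖ < ε} := isOpen_lt (by fun_prop) continuous_const
    obtain ⟨i, hi⟩ := hlim.exists_mem_nhds (CFC.sqrt a) (hopen.mem_nhds (by
      rw [Set.mem_ofPred_eq, hsq]; simpa using hε))
    refine ⟨i, fun j hj => ?_⟩
    obtain ⟨c, hc⟩ := hi j hj
    rw [Set.mem_ofPred_eq, ← map_star, ← map_mul] at hc
    exact ⟨c, hc.le⟩
  obtain ⟨i₁, hi₁⟩ := happrox a ha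
  obtain ⟨i₂, hi₂⟩ := happrox b hb
  obtain ⟨c, hc⟩ := hi₁ (i₁ + i₂) (Nat.le_add_right _ _)
  obtain ⟨d, hd⟩ := hi₂ (i₁ + i₂) (Nat.le_add_left _ _)
  generalize i₁ + i₂ = i at c d hc hd
  set a' := star c * c with ha'
  set b' := star d * d with hb'
  have haa' : IsSelfAdjoint a' := IsSelfAdjoint.star_mul_self c
  have hbb' : IsSelfAdjoint b' := IsSelfAdjoint.star_mul_self d
  have hμa : 0 ≤ μ i a' := by rw [ha', map_mul, map_star]; exact star_mul_self_nonneg _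
  have hμb : 0 ≤ μ i b' := by rw [hb', map_mul, map_star]; exact star_mul_self_nonneg _
  -- compare the cut-downs of `a'` and `b'` at the finitely many levels `p ε`
  obtain ⟨N, hN⟩ := exists_nat_ge ((‖a'‖ + ‖b'‖) / ε)
  rw [div_le_iff₀ hε] at hN
  have hcomp' : ∀ t : ℝ, 0 < t → CuntzLE (cutDown (t + (r + 2 * ε)) (μ i a')) (cutDown t (μ i b')) ∧
      CuntzLE (cutDown (t + (r + 2 * ε)) (μ i b')) (cutDown t (μ i a')) := by
    intro t ht
    have e1 : t + (r + 2 * ε) = (t + ε + r) + ε := by ring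
    rw [e1]
    obtain ⟨h1, h2⟩ := hcomp (t + ε) (by positivity)
    exact ⟨((cuntzLE_cutDown_of_norm_sub_le hμa ha hc (by positivity)).trans h1).trans
      (cuntzLE_cutDown_of_norm_sub_le hb hμb (by rwa [norm_sub_rev]) ht.le),
      ((cuntzLE_cutDown_of_norm_sub_le hμb hb hd (by positivity)).trans h2).trans
      (cuntzLE_cutDown_of_norm_sub_le ha hμa (by rwa [norm_sub_rev]) ht.le)⟩
  obtain ⟨j, ψ, hψ, hj⟩ := hlim.exists_stage_finset (κ := Bool × ℕ) (i := i) (ε := ε)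
    (fun q => cutDown (q.2 * ε + (r + 2 * ε)) (if q.1 then a' else b'))
    (fun q => cutDown (q.2 * ε) (if q.1 then b' else a')) (Finset.univ ×ˢ Finset.Icc 1 N) (by
      rintro ⟨β, p⟩ hp
      simp only [Finset.mem_product, Finset.mem_univ, true_and, Finset.mem_Icc] at hp
      have hp0 : (0 : ℝ) < p * ε := mul_pos (by exact_mod_cast hp.1) hε
      have h := hcomp' (p * ε) hp0
      cases β
      · simp only [Bool.false_eq_true, if_false]
        rw [hom_cutDown _ hbb' (by positivity), hom_cutDown _ haa' hp0.le]
        exact cuntzLE_iff.1 h.2 ε hε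
      · simp only [if_true]
        rw [hom_cutDown _ haa' (by positivity), hom_cutDown _ hbb' hp0.le]
        exact cuntzLE_iff.1 h.1 ε hε)
  obtain ⟨z, hz1, hz2, hz3⟩ := exists_unitary_razakSum (a := ψ a') (b := ψ b') (c := ψ c) (d := ψ d)
    (r := r + 2 * ε) (N := N) (fun q => (hkn j q).2)
    (by rw [ha', map_mul, map_star]) (by rw [hb', map_mul, map_star]) hε (by positivity)
    ((NonUnitalStarAlgHom.norm_apply_le ψ a').trans (by linarith [norm_nonneg b']))
    ((NonUnitalStarAlgHom.norm_apply_le ψ b').trans (by linarith [norm_nonneg a']))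
    (fun p hp1 hpN => by
      have h := hj (true, p) (by simp [hp1, hpN])
      simp only [if_true] at h
      rwa [hom_cutDown _ haa' (by positivity), hom_cutDown _ hbb' (by positivity)] at h)
    (fun p hp1 hpN => by
      have h := hj (false, p) (by simp [hp1, hpN])
      simp only [Bool.false_eq_true, if_false] at h
      rwa [hom_cutDown _ haa' (by positivity), hom_cutDown _ hbb' (by positivity)] at h)
  -- transport the unitary `1 + z` to the limit
  have h1 : μ j z + star (μ j z) + μ j z * star (μ j z) = 0 := by
    rw [← map_star, ← map_mul, ← map_add, ← map_add, hz1, map_zero]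
  have h2 : μ j z + star (μ j z) + star (μ j z) * μ j z = 0 := by
    rw [← map_star, ← map_mul, ← map_add, ← map_add, hz2, map_zero]
  have h3 : dU (μ i a') (μ i b') ≤ r + 2 * ε + 3 * ε := by
    refine (dU_le_of_quasiunitary h1 h2).trans (le_trans ?_ hz3)
    refine le_trans (le_of_eq ?_) (NonUnitalStarAlgHom.norm_apply_le (μ j) _)
    simp only [map_sub, map_add, map_mul, map_star, hψ]
  have h4 := dU_le_of_dist_le (a := a) (b := b) (a' := μ i a') (b' := μ i b')
  rw [norm_sub_rev a, norm_sub_rev b] at h4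
  linarith

end
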